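/- All graphs are finite, undirected and simple. An orientation $\vec G$ of a graph $G$ replaces every edge $\{u,v\}$ by exactly one of the arcs $(u,v)$, $(v,u)$. A cycle $C$ of $G$ is central if $G\setminus V(C)$ has a perfect matching (the graph without vertices has one). The orientation $\vec G$ is Pfaffian if, for every central cycle $C$ of $G$, each of the two consistent (directed-cycle) orientations of $C$ has an odd number of arcs in common with $\vec G$; the graph $G$ is Pfaffian if it admits a Pfaffian orientation. Hamiltonian cycles are counted as undirected subgraphs of $G$. Every cubic (that is, 3-regular) bipartite Pfaffian graph has either zero or at least six distinct Hamiltonian cycles. The bound is tight: the cube graph (whose vertices are the eight strings in $\{0,1\}^3$, two being adjacent if they differ in exactly one position) is a cubic bipartite Pfaffian graph with exactly six distinct Hamiltonian cycles. -/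

import Mathlib

namespace SimpleGraph

variable {V : Type*}

/-- The digraph `D` is an orientation of the simple graph `G`: it consists of exactly one of the
two arcs `(u, v)`, `(v, u)` for every edge `{u, v}` of `G`, and of no other arc. -/
structure IsOrientation (G : SimpleGraph V) (D : Digraph V) : Prop where
  adj_of_arc : ∀ ⦃u v : V⦄, D.Adj u v → G.Adj u v
  arc_of_adj : ∀ ⦃u v : V⦄, G.Adj u v → D.Adj u v ∨ D.Adj v u
  not_both : ∀ ⦃u v : V⦄, D.Adj u v → ¬ D.Adj v u

/-- The closed walk `p` (used when `p` is a cycle) is central in `G`: deleting its vertices from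
`G` leaves a graph that has a perfect matching. -/
def Walk.IsCentral {G : SimpleGraph V} {a : V} (p : G.Walk a a) : Prop :=
  ∃ M : (G.induce {v : V | v ∉ p.support}).Subgraph, M.IsPerfectMatching

open Classical in
/-- The number of steps of the walk `p` that are taken along an arc of `D`.  If `p` is a cycle, this
is the number of arcs that `D` has in common with the orientation of the cycle given by the
direction in which `p` traverses it. -/
noncomputable def Walk.arcsInCommon {G : SimpleGraph V} {a : V} (p : G.Walk a a)
    (D : Digraph V) : ℕ :=
  p.darts.countP (fun d => D.Adj d.fst d.snd)

/-- The digraph `D` is a Pfaffian orientation of `G`: for every central cycle of `G`, each of the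
two consistent orientations of the cycle has an odd number of arcs in common with `D`.  (The
reverse of a cycle, as a walk, is again a cycle, so both of its orientations are covered.) -/
structure IsPfaffianOrientation (G : SimpleGraph V) (D : Digraph V) : Prop where
  isOrientation : G.IsOrientation D
  odd_arcsInCommon : ∀ (a : V) (p : G.Walk a a), p.IsCycle → p.IsCentral →
    Odd (p.arcsInCommon D)

/-- A graph is Pfaffian if it admits a Pfaffian orientation. -/
def IsPfaffian (G : SimpleGraph V) : Prop :=
  ∃ D : Digraph V, G.IsPfaffianOrientation D

/-- The set of Hamiltonian cycles of `G`, as (undirected) subgraphs of `G`: the base point and the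
direction of traversal are forgotten. -/
def hamiltonianCycles [DecidableEq V] (G : SimpleGraph V) : Set G.Subgraph :=
  {H | ∃ (a : V) (p : G.Walk a a), p.IsHamiltonianCycle ∧ p.toSubgraph = H}

/-- The cube graph: its vertices are the eight `0`/`1`-strings of length three, and two of them are
adjacent when they differ in exactly one position. -/
def cubeGraph : SimpleGraph (Fin 3 → Bool) where
  Adj u v := hammingDist u v = 1
  symm := ⟨fun u v h => by rw [hammingDist_comm]; exact h⟩
  loopless := ⟨fun u h => by simp [hammingDist_self] at h⟩

instance : DecidableRel cubeGraph.Adj := fun u v =>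
  inferInstanceAs (Decidable (hammingDist u v = 1))

end SimpleGraph

/-! In a cubic graph the complement of a Hamiltonian cycle is a perfect matching. So Hamiltonian
cycles are counted as matching involutions `m` with `G.rest m` connected; `m u = c` says that the
cycle avoids the edge `uc`.

Parity (`even_ncard_hamMatchings`): every edge `uc` is avoided by an even number of Hamiltonian
cycles. Label the colour class of `c` by `ZMod 2`, with `c` labelled 0, and call a labelling
admissible for `m` if at every `x ≠ u` of the other class the two neighbours in `G.rest m` get
different labels. A connected complement has exactly one admissible labelling, a disconnected one an
even number. Conversely, for a fixed labelling `β` the number of matchings through `uc` admitting it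
is, mod 2, the determinant of the matrix with entries `s x + β w` for adjacent `x`, `w` and 0
otherwise, where `s x` is the sum of `β` over the neighbours of `x`. It is singular: it maps `β` to
`s² + s = 0`, and it is the zero matrix if `β = 0`.

Switching (`exists_hamMatchings`): number the vertices along a Hamiltonian cycle. Orienting all
edges forward is then Pfaffian (`isPfaffianOrientation`). If the complement of a matching has one
forward and one backward edge at every vertex of one class with at most one exception, it is
connected: a component missing the exception would be a central cycle with an even number of forward
arcs. Replacing `m x` by the path neighbour of `x` on the same side keeps this property, and
following such replacements yields an alternating cycle to switch along.

Counting (`six_le_ncard_hamMatchings`): with fewer than six Hamiltonian cycles, parity forbids all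
three edges at a vertex from being avoided by some cycle, so switching from a vertex can be done
without changing its matching edge. Doing this from both ends of a suitable cycle edge must give the
same matching, and `eq_of_forall_toward` shows that such a matching equals `m`. -/

namespace SimpleGraph

/-! ### Matching involutions and enumerations along a Hamiltonian cycle -/

variable {V : Type*}

/-- The involution `m` describes a perfect matching of `G`. -/
structure IsMatchingMap (G : SimpleGraph V) (m : V → V) : Prop where
  adj : ∀ x, G.Adj x (m x)
  invol : ∀ x, m (m x) = x

/-- The graph `G` without the edges `{x, m x}`. -/
def rest (G : SimpleGraph V) (m : V → V) : SimpleGraph V where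
  Adj x y := G.Adj x y ∧ m x ≠ y ∧ m y ≠ x
  symm := ⟨fun _ _ h => ⟨h.1.symm, h.2.2, h.2.1⟩⟩
  loopless := ⟨fun _ h => h.1.ne rfl⟩

/-- Every vertex has exactly three neighbours. -/
def IsCubic (G : SimpleGraph V) : Prop := ∀ x, (G.neighborSet x).ncard = 3

/-- The perfect matchings whose complement is connected; in a cubic graph, they are the complements
of the Hamiltonian cycles. -/
def hamMatchings (G : SimpleGraph V) : Set (V → V) :=
  {m | G.IsMatchingMap m ∧ (G.rest m).Connected}

variable {G : SimpleGraph V} {m : V → V}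

lemma rest_le (G : SimpleGraph V) (m : V → V) : G.rest m ≤ G := fun _ _ h => h.1

namespace IsMatchingMap

lemma eq_iff (hm : G.IsMatchingMap m) {x y : V} : m x = y ↔ m y = x :=
  ⟨fun h => by rw [← h, hm.invol], fun h => by rw [← h, hm.invol]⟩

lemma injective (hm : G.IsMatchingMap m) : Function.Injective m := fun x y h => by
  rw [← hm.invol x, h, hm.invol]

lemma rest_adj (hm : G.IsMatchingMap m) {x y : V} :
    (G.rest m).Adj x y ↔ G.Adj x y ∧ m x ≠ y := by
  refine ⟨fun h => ⟨h.1, h.2.1⟩, fun h => ⟨h.1, h.2, fun h' => h.2 (hm.eq_iff.2 h')⟩⟩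

lemma neighborSet_rest (hm : G.IsMatchingMap m) (x : V) :
    (G.rest m).neighborSet x = G.neighborSet x \ {m x} := by
  ext y
  simp [hm.rest_adj, eq_comm]

lemma ncard_neighborSet_rest (hm : G.IsMatchingMap m) (hG : G.IsCubic) (x : V) :
    ((G.rest m).neighborSet x).ncard = 2 := by
  rw [hm.neighborSet_rest,
    Set.ncard_sdiff_singleton_of_mem ((G.mem_neighborSet x (m x)).2 (hm.adj x)),
    hG x]

lemma isCycles_rest (hm : G.IsMatchingMap m) (hG : G.IsCubic) : (G.rest m).IsCycles :=
  fun x _ => hm.ncard_neighborSet_rest hG x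

lemma exists_rest_neighbors (hm : G.IsMatchingMap m) (hG : G.IsCubic) (x : V) :
    ∃ a b, a ≠ b ∧ ∀ y, (G.rest m).Adj x y ↔ y = a ∨ y = b := by
  obtain ⟨a, b, hab, h⟩ := Set.ncard_eq_two.1 (hm.ncard_neighborSet_rest hG x)
  refine ⟨a, b, hab, fun y => ?_⟩
  rw [← mem_neighborSet, h]
  simp

/-- If `a ≠ b` are two neighbours of `x` other than `m x`, there are no further ones. -/
lemma eq_or_eq_of_rest_adj (hm : G.IsMatchingMap m) (hG : G.IsCubic) {x a b y : V} (hab : a ≠ b)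
    (ha : (G.rest m).Adj x a) (hb : (G.rest m).Adj x b) (hy : (G.rest m).Adj x y) :
    y = a ∨ y = b := by
  obtain ⟨c, d, -, h⟩ := hm.exists_rest_neighbors hG x
  rw [h] at ha hb hy
  grind

lemma exists_other (hm : G.IsMatchingMap m) (hG : G.IsCubic) {x a : V}
    (ha : (G.rest m).Adj x a) :
    ∃ b, b ≠ a ∧ (G.rest m).Adj x b ∧ ∀ y, G.Adj x y → y = m x ∨ y = a ∨ y = b := by
  obtain ⟨c, d, hcd, h⟩ := hm.exists_rest_neighbors hG x
  have key : ∀ y, G.Adj x y → y = m x ∨ y = c ∨ y = d := by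
    intro y hy
    by_cases hyx : m x = y
    · exact Or.inl hyx.symm
    · exact Or.inr ((h y).1 (hm.rest_adj.2 ⟨hy, hyx⟩))
  rcases (h a).1 ha with rfl | rfl
  · exact ⟨d, hcd.symm, (h d).2 (Or.inr rfl), key⟩
  · exact ⟨c, hcd, (h c).2 (Or.inl rfl), fun y hy => by have := key y hy; tauto⟩

end IsMatchingMap

/-- `P 0, P 1, …, P (N - 1)` is an enumeration of the vertices along a Hamiltonian cycle of `F`, and
`pos` is its inverse. -/
structure IsCyclicOrder (F : SimpleGraph V) (N : ℕ) (P : ℕ → V) (pos : V → ℕ) : Prop where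
  pos_lt : ∀ x, pos x < N
  apply_pos : ∀ x, P (pos x) = x
  pos_apply : ∀ i < N, pos (P i) = i
  adj_succ : ∀ i, i + 1 < N → F.Adj (P i) (P (i + 1))
  adj_last : F.Adj (P (N - 1)) (P 0)

variable [Fintype V]

/-- A cycle that spans the component of `u` and ends with a prescribed edge. -/
lemma IsMatchingMap.exists_isCycle_rest (hm : G.IsMatchingMap m) (hG : G.IsCubic)
    (u : V) : ∃ p : (G.rest m).Walk u u, p.IsCycle ∧
      ∀ x, x ∈ p.support ↔ (G.rest m).Reachable x u := by
  obtain ⟨p, hp, hv⟩ :=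
    (hm.isCycles_rest hG).exists_cycle_toSubgraph_verts_eq_connectedComponentSupp
    (v := u) (c := (G.rest m).connectedComponentMk u) rfl
    (Set.nonempty_of_ncard_ne_zero (by rw [hm.ncard_neighborSet_rest hG]; simp))
  refine ⟨p, hp, fun x => ?_⟩
  rw [← Walk.mem_verts_toSubgraph, hv, ConnectedComponent.mem_supp_iff, ConnectedComponent.eq]

lemma exists_isCyclicOrder (hG : G.IsCubic) (hm : m ∈ G.hamMatchings) {u b : V}
    (hub : (G.rest m).Adj u b) :
    ∃ N P pos, IsCyclicOrder (G.rest m) N P pos ∧ P 0 = u ∧ P (N - 1) = b := by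
  classical
  obtain ⟨hm, hc⟩ := hm
  obtain ⟨p, hp, hs, hb⟩ : ∃ p : (G.rest m).Walk u u, p.IsCycle ∧ (∀ x, x ∈ p.support) ∧
      p.penultimate = b := by
    obtain ⟨p, hp, hs⟩ := hm.exists_isCycle_rest hG u
    have hs' : ∀ x, x ∈ p.support := fun x => (hs x).2 (hc.preconnected x u)
    have h1 := p.adj_penultimate hp.not_nil
    have h2 := p.adj_snd hp.not_nil
    -- The second and the penultimate vertex are the only two neighbours of `u` in the complement,
    -- so `b` is one of them, and reversing the cycle if necessary puts it last.
    rcases hm.eq_or_eq_of_rest_adj hG hp.snd_ne_penultimate h2 h1.symm hub with h | h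
    · refine ⟨p.reverse, hp.reverse, by simpa using hs', ?_⟩
      rw [Walk.penultimate_reverse, h]
    · exact ⟨p, hp, hs', h.symm⟩
  have hlen := hp.three_le_length
  have hex : ∀ x, ∃ i, i < p.length ∧ p.getVert i = x := by
    intro x
    obtain ⟨i, hi, hil⟩ := Walk.mem_support_iff_exists_getVert.1 (hs x)
    rcases hil.lt_or_eq with h | h
    · exact ⟨i, h, hi⟩
    · refine ⟨0, by omega, ?_⟩
      rw [← hi, h, Walk.getVert_length, Walk.getVert_zero]
  choose pos hpos hP using hex
  have hinj := hp.getVert_injOn'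
  refine ⟨p.length, p.getVert, pos, ⟨hpos, hP, fun i hi => ?_, fun i hi => ?_, ?_⟩, by simp, hb⟩
  · exact hinj (by have := hpos (p.getVert i); simp; omega) (by simp; omega) (hP _)
  · exact p.adj_getVert_succ (by omega)
  · have := p.adj_penultimate hp.not_nil
    simpa [Walk.penultimate] using this

end SimpleGraph

/-! ### Hamiltonian cycles as complements of perfect matchings -/

namespace SimpleGraph

variable {V : Type*} {G : SimpleGraph V} {m : V → V}

/-- The complement of a perfect matching as a spanning subgraph. -/
def restSubgraph (G : SimpleGraph V) (m : V → V) : G.Subgraph where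
  verts := Set.univ
  Adj := (G.rest m).Adj
  adj_sub h := h.1
  edge_vert _ := Set.mem_univ _
  symm := ⟨fun _ _ h => h.symm⟩

lemma restSubgraph_injOn (G : SimpleGraph V) :
    Set.InjOn G.restSubgraph {m | G.IsMatchingMap m} := by
  intro m hm m' hm' h
  ext x
  have h1 : (G.rest m).Adj x (m x) ↔ (G.rest m').Adj x (m x) := by
    have := congrArg (fun H : G.Subgraph => H.Adj x (m x)) h
    exact Iff.of_eq this
  rw [IsMatchingMap.rest_adj hm, IsMatchingMap.rest_adj hm'] at h1
  have h2 := IsMatchingMap.adj hm x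
  grind

/-- In a cubic graph, the Hamiltonian cycles are the connected complements of perfect matchings. -/
lemma image_restSubgraph_hamMatchings [Fintype V] [DecidableEq V] (hG : G.IsCubic) :
    G.restSubgraph '' G.hamMatchings = G.hamiltonianCycles := by
  ext H
  constructor
  · rintro ⟨m, ⟨hm, hc⟩, rfl⟩
    obtain ⟨u⟩ := hc.nonempty
    obtain ⟨p, hp, hs⟩ := hm.exists_isCycle_rest hG u
    have hs' : ∀ x, x ∈ p.support := fun x => (hs x).2 (hc.preconnected x u)
    refine ⟨u, p.mapLe (G.rest_le m), ?_, ?_⟩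
    · have hp' : (p.mapLe (G.rest_le m)).IsCycle := hp.mapLe _
      rw [Walk.isHamiltonianCycle_iff_isCycle_and_support_count_tail_eq_one]
      refine ⟨hp', fun x => ?_⟩
      refine List.count_eq_one_of_mem hp'.support_nodup ?_
      have := hs' x
      rw [Walk.support_mapLe_eq_support]
      rw [Walk.mem_support_iff] at this
      rcases this with rfl | h
      · exact Walk.end_mem_tail_support hp.not_nil
      · exact h
    · ext x y
      · simp [restSubgraph, hs']
      · classical
        rw [Walk.adj_toSubgraph_mapLe]
        exact hp.adj_toSubgraph_iff_of_isCycles (hm.isCycles_rest hG)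
          (p.mem_verts_toSubgraph.2 (hs' x)) y
  · rintro ⟨a, p, hp, rfl⟩
    have hp' := hp.isCycle
    have hmem : ∀ x, x ∈ p.support := hp.mem_support
    have h2 : ∀ x, (p.toSubgraph.neighborSet x).ncard = 2 := fun x =>
      hp'.ncard_neighborSet_toSubgraph_eq_two (hmem x)
    have h1 : ∀ x, ∃ y, G.neighborSet x \ p.toSubgraph.neighborSet x = {y} := by
      intro x
      rw [← Set.ncard_eq_one, Set.ncard_sdiff (p.toSubgraph.neighborSet_subset x), h2, hG x]
    choose m hm using h1
    have key : ∀ x y, m x = y ↔ G.Adj x y ∧ ¬ p.toSubgraph.Adj x y := by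
      intro x y
      have : y ∈ G.neighborSet x \ p.toSubgraph.neighborSet x ↔ y = m x := by rw [hm]; simp
      simpa [eq_comm] using this.symm
    have hmm : G.IsMatchingMap m := by
      refine ⟨fun x => ((key x _).1 rfl).1, fun x => ?_⟩
      obtain ⟨h3, h4⟩ := (key x _).1 rfl
      exact (key _ _).2 ⟨h3.symm, fun h => h4 h.symm⟩
    have hadj : ∀ x y, (G.rest m).Adj x y ↔ p.toSubgraph.Adj x y := by
      intro x y
      rw [hmm.rest_adj, Ne, key]
      have := p.toSubgraph.adj_sub (v := x) (w := y)
      tauto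
    refine ⟨m, ⟨hmm, ?_⟩, ?_⟩
    · have hq : ∀ e ∈ p.edges, e ∈ (G.rest m).edgeSet := by
        intro e
        induction e with
        | _ x y =>
          intro h
          rw [mem_edgeSet, hadj]
          exact (p.mem_edges_toSubgraph (e := s(x, y))).2 h
      have hr : ∀ x, (G.rest m).Reachable a x := fun x =>
        ⟨(p.transfer _ hq).takeUntil x (by rw [Walk.support_transfer]; exact hmem x)⟩
      exact (connected_iff _).2 ⟨fun x y => (hr x).symm.trans (hr y), ⟨a⟩⟩
    · ext x y
      · simp [restSubgraph, hmem]
      · exact hadj x y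

lemma ncard_hamiltonianCycles [Fintype V] [DecidableEq V] (hG : G.IsCubic) :
    G.hamiltonianCycles.ncard = G.hamMatchings.ncard := by
  rw [← image_restSubgraph_hamMatchings hG,
    Set.InjOn.ncard_image (G.restSubgraph_injOn.mono fun _ h => h.1)]

end SimpleGraph

/-! ### Central cycles and a criterion for a connected complement -/

namespace SimpleGraph

variable {V : Type*} {G : SimpleGraph V} {m : V → V} {D : Digraph V}

lemma _root_.Bool.eq_of_ne_of_ne {a b c : Bool} (h : a ≠ c) (h' : b ≠ c) : a = b := by
  revert a b c; decide

lemma IsOrientation.adj_iff_not (hD : G.IsOrientation D) {x y : V} (h : G.Adj x y) :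
    D.Adj x y ↔ ¬ D.Adj y x :=
  ⟨fun h' => hD.not_both h', fun h' => (hD.arc_of_adj h).resolve_right h'⟩

/-- A closed walk is central if the remaining vertices are matched by some involution. -/
lemma Walk.isCentral_of_involution {a : V} {p : G.Walk a a} (μ : V → V)
    (h1 : ∀ x ∉ p.support, G.Adj x (μ x)) (h2 : ∀ x ∉ p.support, μ x ∉ p.support)
    (h3 : ∀ x ∉ p.support, μ (μ x) = x) : p.IsCentral := by
  refine ⟨⟨Set.univ, fun x y => μ x = y, fun {x y} h => ?_, fun _ => Set.mem_univ _,
    ⟨fun x y h => ?_⟩⟩, ?_, fun _ => Set.mem_univ _⟩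
  · have := h1 x x.2
    rw [h] at this
    exact this
  · rw [← h, h3 x x.2]
  · intro x _
    exact ⟨⟨μ x, h2 x x.2⟩, rfl, fun y hy => Subtype.ext (Eq.symm (show μ x = y from hy))⟩

/-- A bipartite `2`-regular graph has a perfect matching. -/
lemma exists_isMatchingMap_of_two_regular [Finite V] {F : SimpleGraph V} (C : F.Coloring Bool)
    (hF : ∀ x, (F.neighborSet x).ncard = 2) : ∃ μ, F.IsMatchingMap μ := by
  classical
  have := Fintype.ofFinite V
  have hbip : F.IsBipartiteWith {x | C x = true} {x | C x = false} := by
    refine ⟨Set.disjoint_left.2 fun x h h' => ?_, fun x y h => ?_⟩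
    · simp_all
    · have := C.valid h
      simp only [Set.mem_ofPred_eq]
      revert this
      cases C x <;> cases C y <;> simp
  obtain ⟨M, hM⟩ := exists_isPerfectMatching_of_forall_ncard_le hbip (fun s => by
    -- Hall's condition by double counting: every vertex of `s` sends out two edges and every
    -- neighbour receives at most two.
    have key : s.toFinset.card * 2 ≤ (s.toFinset.biUnion fun x => F.neighborFinset x).card * 2 := by
      refine Finset.card_mul_le_card_mul F.Adj (fun x hx => ?_) (fun y _ => ?_)
      · rw [← hF x, ← Set.ncard_coe_finset]
        refine Set.ncard_le_ncard (fun y hy => ?_) (Set.toFinite _)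
        simp only [Finset.bipartiteAbove, Finset.coe_filter, Finset.mem_biUnion, Set.mem_ofPred_eq,
          mem_neighborFinset]
        exact ⟨⟨x, hx, hy⟩, hy⟩
      · rw [← hF y, ← Set.ncard_coe_finset]
        refine Set.ncard_le_ncard (fun x hx => ?_) (Set.toFinite _)
        simp only [Finset.bipartiteBelow, Finset.coe_filter, Set.mem_ofPred_eq] at hx
        exact hx.2.symm
    have h2 : (⋃ x ∈ s, F.neighborSet x) =
        (s.toFinset.biUnion (fun x => F.neighborFinset x) : Finset V) := by
      ext y; simp
    rw [h2, Set.ncard_coe_finset, Set.ncard_eq_toFinset_card']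
    omega)
  have hu := hM.1
  have hs := hM.2
  choose μ hμ hμ' using fun x => hu (hs x)
  exact ⟨μ, fun x => M.adj_sub (hμ x), fun x => (hμ' (μ x) x (hμ x).symm).symm⟩

/-- A trail between two vertices of one colour class that passes every vertex of the other
class along one incoming and one outgoing arc has an even number of arcs in common with `D`. -/
lemma even_countP_darts (hD : G.IsOrientation D) (C : G.Coloring Bool) {c : Bool} :
    ∀ {a b : V} (p : G.Walk a b), p.edges.Nodup → C a ≠ c → C b ≠ c →
      (∀ x y z, C x = c → s(x, y) ∈ p.edges → s(x, z) ∈ p.edges → y ≠ z →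
        (D.Adj x y ↔ ¬ D.Adj x z)) →
      ∀ _inst : DecidablePred fun d : G.Dart => D.Adj d.fst d.snd,
      Even (p.darts.countP (fun d => D.Adj d.fst d.snd))
  | _, _, .nil, _, _, _, _ => by simp
  | _, _, .cons h .nil, _, h2, h3, _ => 
    absurd (Bool.eq_of_ne_of_ne h2 h3) (C.valid h)
  | a, _, .cons (v := x) h (.cons (v := z) h' p), h1, h2, h3, h4 => by
    intro _inst
    have hx : C x = c := Bool.eq_of_ne_of_ne (C.valid h).symm h2.symm
    have hz : C z ≠ c := fun hz => C.valid h' (hx.trans hz.symm)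
    simp only [Walk.edges_cons, List.nodup_cons, List.mem_cons] at h1
    have ih := even_countP_darts hD C p h1.2.2 hz h3 (fun x' y' z' hx' hy' hz' hne =>
      h4 x' y' z' hx' (by simp [hy']) (by simp [hz']) hne) _inst
    have haz : a ≠ z := by
      rintro rfl
      exact h1.1 (Or.inl Sym2.eq_swap)
    -- The two steps `a → x → z` follow `D` together or not at all, so they contribute 0 or 2.
    have := h4 x a z hx (by simp [Sym2.eq_swap]) (by simp) haz
    rw [hD.adj_iff_not h.symm] at this
    simp only [Walk.darts_cons, List.countP_cons]
    by_cases hxz : D.Adj x z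
    · have : D.Adj a x := by tauto
      simp only [hxz, this, decide_true, if_true]
      rw [Nat.even_iff] at ih ⊢
      omega
    · have : ¬ D.Adj a x := by tauto
      simpa [hxz, this] using ih

end SimpleGraph

namespace SimpleGraph

variable {V : Type*} {G : SimpleGraph V} {m : V → V} {D : Digraph V}

/-- If the complement of a perfect matching passes every vertex of one colour class, with at most
one exception, along one incoming and one outgoing arc of a Pfaffian orientation, then it is
connected. -/
lemma IsMatchingMap.connected_rest [Fintype V] (hm : G.IsMatchingMap m) (hG : G.IsCubic)
    (C : G.Coloring Bool) (hD : G.IsPfaffianOrientation D) (v : V)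
    (h : ∀ x y z, C x = C v → x ≠ v → (G.rest m).Adj x y → (G.rest m).Adj x z → y ≠ z →
      (D.Adj x y ↔ ¬ D.Adj x z)) : (G.rest m).Connected := by
  classical
  have hle := G.rest_le m
  suffices hr : ∀ w, (G.rest m).Reachable w v from
    (connected_iff _).2 ⟨fun x y => (hr x).trans (hr y).symm, ⟨v⟩⟩
  suffices hr : ∀ w, C w ≠ C v → (G.rest m).Reachable w v by
    intro w
    by_cases hw : C w = C v
    · obtain ⟨a, b, -, hab⟩ := hm.exists_rest_neighbors hG w
      have hwa := (hab a).2 (Or.inl rfl)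
      exact hwa.reachable.trans (hr a fun h' => C.valid (hle hwa) (hw.trans h'.symm))
    · exact hr w hw
  intro w hw
  by_contra hwv
  obtain ⟨p, hp, hs⟩ := hm.exists_isCycle_rest hG w
  -- A matching inside the complement never leaves a component, so it restricts to the vertices off
  -- `p`, which makes `p` central.
  obtain ⟨μ, hμ⟩ := exists_isMatchingMap_of_two_regular (F := G.rest m)
    (C.comp (Hom.ofLE hle)) (hm.ncard_neighborSet_rest hG)
  have hcen : (p.mapLe hle).IsCentral := by
    refine Walk.isCentral_of_involution μ (fun x _ => hle (hμ.adj x)) (fun x hx hx' => ?_)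
      (fun x _ => hμ.invol x)
    rw [Walk.support_mapLe_eq_support, hs] at hx hx'
    exact hx ((hμ.adj x).reachable.trans hx')
  have hodd := hD.odd_arcsInCommon w _ (hp.mapLe hle) hcen
  have heven : Even ((p.mapLe hle).arcsInCommon D) := by
    have hed : ∀ x y, s(x, y) ∈ (p.mapLe hle).edges → x ≠ v ∧ (G.rest m).Adj x y := by
      intro x y hxy
      rw [Walk.edges_mapLe_eq_edges] at hxy
      refine ⟨?_, p.adj_of_mem_edges hxy⟩
      rintro rfl
      exact hwv ((hs x).1 (p.fst_mem_support_of_mem_edges hxy)).symm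
    refine even_countP_darts hD.isOrientation C (p.mapLe hle) (hp.mapLe hle).edges_nodup hw hw ?_ _
    intro x y z hx hy hz hyz
    exact h x y z hx (hed x y hy).1 (hed x y hy).2 (hed x z hz).2 hyz
  exact (Nat.not_even_iff_odd.2 hodd) heven

end SimpleGraph

/-! ### The Pfaffian orientation given by a Hamiltonian cycle -/

namespace SimpleGraph

variable {V : Type*} {G F : SimpleGraph V} {N : ℕ} {P : ℕ → V} {pos : V → ℕ}

namespace IsCyclicOrder

lemma pos_injective (h : IsCyclicOrder F N P pos) : Function.Injective pos := fun x y hxy => by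
  rw [← h.apply_pos x, hxy, h.apply_pos]

lemma color_apply (h : IsCyclicOrder F N P pos) (C : F.Coloring Bool) :
    ∀ i < N, (C (P i) = C (P 0) ↔ Even i)
  | 0, _ => by simp
  | i + 1, hi => by
    have ih := color_apply h C i (by omega)
    have := C.valid (h.adj_succ i hi)
    rw [Nat.even_add_one, ← ih]
    revert this
    generalize C (P i) = a
    generalize C (P (i + 1)) = b
    generalize C (P 0) = c
    revert a b c; decide

lemma color_eq_iff (h : IsCyclicOrder F N P pos) (C : F.Coloring Bool) (x y : V) :
    C x = C y ↔ (Even (pos x) ↔ Even (pos y)) := by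
  have h1 := h.color_apply C _ (h.pos_lt x)
  have h2 := h.color_apply C _ (h.pos_lt y)
  rw [h.apply_pos] at h1 h2
  rw [← h1, ← h2]
  generalize C x = a
  generalize C y = b
  generalize C (P 0) = c
  revert a b c; decide

lemma pos_parity (h : IsCyclicOrder F N P pos) (C : F.Coloring Bool) {x y : V} (hxy : C x ≠ C y) :
    (pos x + pos y) % 2 = 1 := by
  rw [Ne, h.color_eq_iff C] at hxy
  grind

lemma pos_pos (h : IsCyclicOrder F N P pos) : 0 < N := (Nat.zero_le _).trans_lt (h.pos_lt (P 0))

lemma even_card (h : IsCyclicOrder F N P pos) (C : F.Coloring Bool) : N % 2 = 0 := by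
  have := h.pos_parity C (C.valid h.adj_last)
  have h0 := h.pos_pos
  rw [h.pos_apply _ (by omega), h.pos_apply _ h0] at this
  omega

end IsCyclicOrder

/-- The orientation of every edge from the smaller to the larger value of `pos`. -/
def posOrientation (G : SimpleGraph V) (pos : V → ℕ) : Digraph V where
  Adj x y := G.Adj x y ∧ pos x < pos y

open Classical in
/-- The indicator of an arc. -/
noncomputable def arcInd (D : Digraph V) (x y : V) : ZMod 2 := if D.Adj x y then 1 else 0

lemma IsOrientation.arcInd_swap {D : Digraph V} (hD : G.IsOrientation D) {x y : V}
    (h : G.Adj x y) : arcInd D y x = 1 + arcInd D x y := by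
  have := hD.adj_iff_not h
  unfold arcInd
  by_cases h1 : D.Adj x y <;> (simp_all; try rfl)

lemma Walk.cast_countP_darts (D : Digraph V) {a b : V} (p : G.Walk a b)
    (_inst : DecidablePred fun d : G.Dart => D.Adj d.fst d.snd) :
    ((p.darts.countP (fun d => D.Adj d.fst d.snd) : ℕ) : ZMod 2) =
      (p.darts.map fun d => arcInd D d.fst d.snd).sum := by
  induction p with
  | nil => simp
  | cons h p ih =>
    simp only [Walk.darts_cons, List.countP_cons, List.map_cons, List.sum_cons, Nat.cast_add, ih,
      arcInd]
    rw [add_comm]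
    congr 1
    split_ifs <;> simp_all

/-- Switching at a set of vertices does not change the parity for closed walks. -/
lemma Walk.sum_arcInd_switch {D D' : Digraph V} (γ : V → ZMod 2)
    (h : ∀ x y, G.Adj x y → arcInd D' x y = arcInd D x y + γ x + γ y) {a b : V} (p : G.Walk a b) :
    (p.darts.map fun d => arcInd D' d.fst d.snd).sum =
      (p.darts.map fun d => arcInd D d.fst d.snd).sum + γ a + γ b := by
  induction p with
  | nil => simp [CharTwo.add_self_eq_zero]
  | @cons u v w hd p ih =>
    simp only [Walk.darts_cons, List.map_cons, List.sum_cons, ih, h _ _ hd]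
    linear_combination CharTwo.add_self_eq_zero (γ v)

/-- The segment of the enumeration from `P i` to `P j`, as a path. -/
lemma IsCyclicOrder.exists_walk (h : IsCyclicOrder F N P pos) (hF : F ≤ G) :
    ∀ k i j : ℕ, i + k = j → j < N → ∃ w : G.Walk (P i) (P j), w.IsPath ∧
      (∀ x, x ∈ w.support ↔ i ≤ pos x ∧ pos x ≤ j) ∧
      (∀ e ∈ w.edges, ∃ t, e = s(P t, P (t + 1)) ∧ i ≤ t ∧ t < j) ∧
      ∀ (f : V → V → ZMod 2) (γ : V → ZMod 2),
        (∀ t, t + 1 < N → f (P t) (P (t + 1)) = 1 + γ (P t) + γ (P (t + 1))) →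
        (w.darts.map fun d => f d.fst d.snd).sum = k + γ (P i) + γ (P j)
  | 0, i, j, hij, hj => by
    obtain rfl : i = j := by omega
    refine ⟨.nil, by simp, fun x => ?_, by simp, fun f γ _ => ?_⟩
    · rw [Walk.support_nil, List.mem_singleton]
      constructor
      · rintro rfl
        simp [h.pos_apply _ hj]
      · intro hx
        rw [← h.apply_pos x]
        congr 1
        omega
    · simp [CharTwo.add_self_eq_zero]
  | k + 1, i, j, hij, hj => by
    obtain ⟨w, hw, hs, he, hf⟩ := h.exists_walk hF k (i + 1) j (by omega) hj
    have hpi := h.pos_apply i (by omega)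
    refine ⟨.cons (hF (h.adj_succ i (by omega))) w, ?_, fun x => ?_, fun e hew => ?_,
      fun f γ hfγ => ?_⟩
    · rw [Walk.cons_isPath_iff]
      refine ⟨hw, fun hmem => ?_⟩
      rw [hs] at hmem
      omega
    · rw [Walk.support_cons, List.mem_cons, hs]
      constructor
      · rintro (rfl | hx) <;> omega
      · intro hx
        rcases hx.1.lt_or_eq with h1 | h1
        · exact Or.inr ⟨h1, hx.2⟩
        · left
          rw [h1, h.apply_pos]
    · rw [Walk.edges_cons, List.mem_cons] at hew
      rcases hew with rfl | hew
      · exact ⟨i, rfl, le_rfl, by omega⟩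
      · obtain ⟨t, rfl, h1, h2⟩ := he e hew
        exact ⟨t, rfl, by omega, h2⟩
    · simp only [Walk.darts_cons, List.map_cons, List.sum_cons, hf f γ hfγ, hfγ i (by omega)]
      push_cast
      linear_combination CharTwo.add_self_eq_zero (γ (P (i + 1)))

/-- The vertices outside a segment of odd length of a Hamiltonian cycle are perfectly matched. -/
lemma IsCyclicOrder.exists_involution (h : IsCyclicOrder F N P pos) (hN : N % 2 = 0) {i j : ℕ}
    (hij : (i + j) % 2 = 1) (hj : j < N) :
    ∃ μ : V → V, (∀ x, F.Adj x (μ x)) ∧ (∀ x, μ (μ x) = x) ∧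
      ∀ x, ¬ (i ≤ pos x ∧ pos x ≤ j) → ¬ (i ≤ pos (μ x) ∧ pos (μ x) ≤ j) := by
  obtain ⟨r, hr, hr1, hr2, hr3⟩ : ∃ r : ℕ → ℕ, (∀ t < N, r t < N) ∧
      (∀ t < N, r (r t) = t) ∧ (∀ t < N, F.Adj (P t) (P (r t))) ∧
      ∀ t < N, ¬ (i ≤ t ∧ t ≤ j) → ¬ (i ≤ r t ∧ r t ≤ j) := by
    have hs : ∀ t, 0 < t → t < N → F.Adj (P t) (P (t - 1)) := fun t h0 ht => by
      have := h.adj_succ (t - 1) (by omega)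
      rw [Nat.sub_add_cancel h0] at this
      exact this.symm
    -- The segment has evenly many vertices. Pairing consecutive positions, with the pairs starting
    -- at the parity of `i`, never crosses its boundary; for odd `i` the positions `N - 1` and `0`
    -- are paired.
    rcases Nat.mod_two_eq_zero_or_one i with hi | hi
    · refine ⟨fun t => if t % 2 = 0 then t + 1 else t - 1, fun t ht => ?_, fun t ht => ?_,
        fun t ht => ?_, fun t ht => ?_⟩
      · dsimp only; split_ifs <;> omega
      · dsimp only; split_ifs <;> omega
      · dsimp only; split_ifs
        · exact h.adj_succ t (by omega)
        · exact hs t (by omega) ht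
      · dsimp only; split_ifs <;> omega
    · refine ⟨fun t => if t % 2 = 0 then (if t = 0 then N - 1 else t - 1) else
        (if t = N - 1 then 0 else t + 1), fun t ht => ?_, fun t ht => ?_,
        fun t ht => ?_, fun t ht => ?_⟩
      · dsimp only; split_ifs <;> omega
      · dsimp only
        generalize hs : (if t % 2 = 0 then (if t = 0 then N - 1 else t - 1) else
          (if t = N - 1 then 0 else t + 1)) = s
        split_ifs at hs ⊢ <;> omega
      · dsimp only; split_ifs with h1 h2 h2
        · rw [h2]; exact h.adj_last.symm
        · exact hs t (by omega) ht
        · rw [h2]; exact h.adj_last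
        · exact h.adj_succ t (by omega)
      · dsimp only; split_ifs <;> omega
  refine ⟨fun x => P (r (pos x)), fun x => ?_, fun x => ?_, fun x hx => ?_⟩
  · have := hr2 _ (h.pos_lt x)
    rwa [h.apply_pos] at this
  · dsimp only
    rw [h.pos_apply _ (hr _ (h.pos_lt x)), hr1 _ (h.pos_lt x), h.apply_pos]
  · rw [h.pos_apply _ (hr _ (h.pos_lt x))]
    exact hr3 _ (h.pos_lt x) hx

/-- Along a Hamiltonian cycle of a bipartite Pfaffian graph, ordering the vertices gives a Pfaffian
orientation. -/
lemma IsCyclicOrder.isPfaffianOrientation (h : IsCyclicOrder F N P pos) (hF : F ≤ G)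
    (C : G.Coloring Bool) (hG : G.IsPfaffian) :
    G.IsPfaffianOrientation (G.posOrientation pos) := by
  classical
  obtain ⟨D, hD⟩ := hG
  have hN : N % 2 = 0 := h.even_card (C.comp (Hom.ofLE hF))
  have hpar : ∀ {x y}, G.Adj x y → (pos x + pos y) % 2 = 1 := fun hxy =>
    h.pos_parity (C.comp (Hom.ofLE hF)) (C.valid hxy)
  have hinj := h.pos_injective
  have hor : G.IsOrientation (G.posOrientation pos) := by
    refine ⟨fun u v huv => huv.1, fun u v huv => ?_, fun u v huv hvu => lt_asymm huv.2 hvu.2⟩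
    rcases lt_or_gt_of_ne (hinj.ne huv.ne) with h1 | h1
    · exact Or.inl ⟨huv, h1⟩
    · exact Or.inr ⟨huv.symm, h1⟩
  -- Chosen so that switching `D` at `γ` turns every edge of the Hamiltonian path forward.
  obtain ⟨g, hg⟩ : ∃ g : ℕ → ZMod 2, ∀ t, g (t + 1) = g t + 1 + arcInd D (P t) (P (t + 1)) :=
    ⟨fun t => Nat.rec 0 (fun t a => a + 1 + arcInd D (P t) (P (t + 1))) t, fun t => rfl⟩
  set γ : V → ZMod 2 := fun x => g (pos x) with hγ
  have hstep : ∀ t, t + 1 < N → arcInd D (P t) (P (t + 1)) = 1 + γ (P t) + γ (P (t + 1)) := by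
    intro t ht
    simp only [hγ, h.pos_apply t (by omega), h.pos_apply (t + 1) ht, hg]
    linear_combination (-1 : ZMod 2) * CharTwo.add_self_eq_zero (g t) -
      CharTwo.add_self_eq_zero (1 : ZMod 2)
  have hlt : ∀ x y, G.Adj x y → pos x < pos y → arcInd D x y = 1 + γ x + γ y := by
    intro x y hxy hlt
    -- Consecutive vertices are handled by `hstep`. Any other edge closes a path segment of odd
    -- length to a central cycle, and the odd number of arcs on it determines the direction of the
    -- edge.
    by_cases hxy1 : pos y = pos x + 1
    · have := hstep (pos x) (by have := h.pos_lt y; omega)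
      rwa [← hxy1, h.apply_pos, h.apply_pos] at this
    have hxy2 := hpar hxy
    obtain ⟨w, hw, hs, he, hf⟩ := h.exists_walk hF (pos y - pos x) (pos x) (pos y) (by omega)
      (h.pos_lt y)
    have hadj : G.Adj (P (pos y)) (P (pos x)) := by
      rw [h.apply_pos, h.apply_pos]; exact hxy.symm
    have hcyc : (Walk.cons hadj w).IsCycle := by
      rw [Walk.cons_isCycle_iff]
      refine ⟨hw, fun hmem => ?_⟩
      obtain ⟨t, h1, h2, h3⟩ := he _ hmem
      have hty := h.pos_lt y
      rw [h.apply_pos, h.apply_pos, Sym2.eq_iff] at h1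
      have e1 := h.pos_apply t (by omega)
      have e2 := h.pos_apply (t + 1) (by omega)
      rcases h1 with ⟨rfl, rfl⟩ | ⟨rfl, rfl⟩ <;> omega
    have hcen : (Walk.cons hadj w).IsCentral := by
      obtain ⟨μ, h1, h2, h3⟩ := h.exists_involution hN (i := pos x) (j := pos y) hxy2 (h.pos_lt y)
      have hsup : ∀ z, z ∈ (Walk.cons hadj w).support ↔ pos x ≤ pos z ∧ pos z ≤ pos y := by
        intro z
        rw [Walk.support_cons, List.mem_cons, hs, h.apply_pos]
        constructor
        · rintro (rfl | hz)
          · omega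
          · exact hz
        · exact Or.inr
      refine Walk.isCentral_of_involution μ (fun z _ => hF (h1 z)) (fun z hz => ?_)
        (fun z _ => h2 z)
      rw [hsup] at hz ⊢
      exact h3 z hz
    have hodd := hD.odd_arcsInCommon _ _ hcyc hcen
    rw [← ZMod.natCast_eq_one_iff_odd, Walk.arcsInCommon, Walk.cast_countP_darts, Walk.darts_cons,
      List.map_cons, List.sum_cons, hf _ γ hstep] at hodd
    have hk : ((pos y - pos x : ℕ) : ZMod 2) = 1 := by
      rw [ZMod.natCast_eq_one_iff_odd, Nat.odd_iff]
      omega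
    simp only [h.apply_pos, hk, hD.isOrientation.arcInd_swap hxy] at hodd
    linear_combination hodd - CharTwo.add_self_eq_zero (1 : ZMod 2) -
      CharTwo.add_self_eq_zero (γ x) - CharTwo.add_self_eq_zero (γ y)
  have hsw : ∀ x y, G.Adj x y →
      arcInd (G.posOrientation pos) x y = arcInd D x y + γ x + γ y := by
    intro x y hxy
    rcases lt_or_gt_of_ne (hinj.ne hxy.ne) with h1 | h1
    · have : arcInd (G.posOrientation pos) x y = 1 := if_pos ⟨hxy, h1⟩
      rw [this, hlt x y hxy h1]
      linear_combination (-1 : ZMod 2) * (CharTwo.add_self_eq_zero (γ x)) -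
        CharTwo.add_self_eq_zero (γ y)
    · have : arcInd (G.posOrientation pos) x y = 0 := if_neg fun h' => lt_asymm h1 h'.2
      rw [this, hD.isOrientation.arcInd_swap hxy.symm, hlt y x hxy.symm h1]
      linear_combination (-1 : ZMod 2) * (CharTwo.add_self_eq_zero (γ x)) -
        CharTwo.add_self_eq_zero (γ y) - CharTwo.add_self_eq_zero (1 : ZMod 2)
  refine ⟨hor, fun a p hp hc => ?_⟩
  have hodd := hD.odd_arcsInCommon a p hp hc
  rw [← ZMod.natCast_eq_one_iff_odd, Walk.arcsInCommon, Walk.cast_countP_darts] at hodd ⊢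
  rw [Walk.sum_arcInd_switch γ hsw, hodd, add_assoc, CharTwo.add_self_eq_zero, add_zero]

end SimpleGraph

/-! ### Switching a Hamiltonian cycle along an alternating cycle -/

lemma Function.bijOn_orbit_of_mem_periodicPts {α : Type*} {f : α → α} {w : α}
    (hw : w ∈ Function.periodicPts f) :
    Set.BijOn f {x | ∃ k, f^[k] w = x} {x | ∃ k, f^[k] w = x} := by
  obtain ⟨n, hn, hp⟩ := hw
  refine ⟨?_, ?_, ?_⟩
  · rintro _ ⟨k, rfl⟩
    exact ⟨k + 1, Function.iterate_succ_apply' f k w⟩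
  · refine (Function.bijOn_periodicPts f).injOn.mono ?_
    rintro _ ⟨k, rfl⟩
    exact ⟨n, hn, hp.apply_iterate k⟩
  · rintro _ ⟨k, rfl⟩
    refine ⟨f^[k + (n - 1)] w, ⟨_, rfl⟩, ?_⟩
    rw [← Function.iterate_succ_apply' f, Nat.succ_eq_add_one, add_assoc, Nat.sub_add_cancel hn,
      Function.iterate_add_apply, hp.eq]

lemma Function.exists_iterate_mem_periodicPts {α : Type*} [Finite α] (f : α → α) (c : α) :
    ∃ i, f^[i] c ∈ Function.periodicPts f := by
  obtain ⟨i, j, hij, h⟩ := Finite.exists_ne_map_eq_of_infinite fun k => f^[k] c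
  wlog hlt : i < j generalizing i j
  · exact this j i hij.symm h.symm (by omega)
  refine ⟨i, j - i, by omega, ?_⟩
  rw [Function.IsPeriodicPt, Function.IsFixedPt, ← Function.iterate_add_apply,
    Nat.sub_add_cancel hlt.le]
  exact h.symm

namespace SimpleGraph

variable {V : Type*} {G F : SimpleGraph V} {N : ℕ} {P : ℕ → V} {pos : V → ℕ} {m : V → V}

/-- Switching a perfect matching along the alternating cycles through `z`, `m z` and `ψ z`. -/
lemma IsMatchingMap.exists_switch (hm : G.IsMatchingMap m) (ψ : V → V) {Z : Set V}
    (hψ : Set.BijOn ψ Z Z) (hZ : ∀ z ∈ Z, m z ∉ Z) (hadj : ∀ z ∈ Z, G.Adj (m z) (ψ z)) :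
    ∃ m', G.IsMatchingMap m' ∧ (∀ z ∈ Z, m' (m z) = ψ z) ∧
      ∀ x, x ∉ Z → m x ∉ Z → m' x = m x := by
  classical
  have hθ : ∀ x : V, ∃ z, x ∈ Z → z ∈ Z ∧ ψ z = x := by
    intro x
    by_cases hx : x ∈ Z
    · obtain ⟨z, hz, rfl⟩ := hψ.surjOn hx
      exact ⟨z, fun _ => ⟨hz, rfl⟩⟩
    · exact ⟨x, fun h => absurd h hx⟩
  choose θ hθ using hθ
  have hθψ : ∀ z ∈ Z, θ (ψ z) = z := fun z hz =>
    hψ.injOn (hθ _ (hψ.mapsTo hz)).1 hz (hθ _ (hψ.mapsTo hz)).2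
  -- `θ` inverts `ψ` on `Z`, and `Z` is disjoint from its set of partners, so the first two cases
  -- are inverse to each other.
  set m' : V → V := fun x => if x ∈ Z then m (θ x) else if m x ∈ Z then ψ (m x) else m x with hm'
  have h1 : ∀ x, x ∈ Z → m' x = m (θ x) := fun x hx => if_pos hx
  have h2 : ∀ x, x ∉ Z → m x ∈ Z → m' x = ψ (m x) := fun x hx hx' =>
    (if_neg hx).trans (if_pos hx')
  have h3 : ∀ x, x ∉ Z → m x ∉ Z → m' x = m x := fun x hx hx' => (if_neg hx).trans (if_neg hx')
  refine ⟨m', ⟨fun x => ?_, fun x => ?_⟩, fun z hz => ?_, h3⟩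
  · by_cases hx : x ∈ Z
    · rw [h1 x hx]
      have := hadj _ (hθ x hx).1
      rw [(hθ x hx).2] at this
      exact this.symm
    · by_cases hx' : m x ∈ Z
      · rw [h2 x hx hx']
        have := hadj _ hx'
        rwa [hm.invol] at this
      · rw [h3 x hx hx']
        exact hm.adj x
  · by_cases hx : x ∈ Z
    · have hz := (hθ x hx).1
      rw [h1 x hx, h2 _ (hZ _ hz) (by rwa [hm.invol]), hm.invol, (hθ x hx).2]
    · by_cases hx' : m x ∈ Z
      · rw [h2 x hx hx', h1 _ (hψ.mapsTo hx'), hθψ _ hx', hm.invol]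
      · rw [h3 x hx hx', h3 _ hx' (by rwa [hm.invol]), hm.invol]
  · rw [h2 _ (hZ z hz) (by rwa [hm.invol]), hm.invol]

namespace IsCyclicOrder

/-- The reversed enumeration. -/
lemma reverse (h : IsCyclicOrder F N P pos) :
    IsCyclicOrder F N (fun i => P (N - 1 - i)) (fun x => N - 1 - pos x) := by
  have h0 := h.pos_pos
  refine ⟨fun x => by omega, fun x => ?_, fun i hi => ?_, fun i hi => ?_, ?_⟩
  · have := h.pos_lt x
    rw [show N - 1 - (N - 1 - pos x) = pos x by omega, h.apply_pos]
  · rw [h.pos_apply _ (by omega)]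
    omega
  · have := h.adj_succ (N - 1 - (i + 1)) (by omega)
    rw [show N - 1 - (i + 1) + 1 = N - 1 - i by omega] at this
    exact this.symm
  · simpa using h.adj_last.symm

/-- The neighbour of `y` on the Hamiltonian path `P` in the direction of `z`. -/
def toward (P : ℕ → V) (pos : V → ℕ) (y z : V) : V :=
  if pos y < pos z then P (pos y + 1) else P (pos y - 1)

/-- Lets switchings started from the two ends of the path be compared by one and the same rule. -/
lemma toward_reverse (h : IsCyclicOrder F N P pos) {y z : V} (hyz : y ≠ z) :
    toward (fun i => P (N - 1 - i)) (fun x => N - 1 - pos x) y z = toward P pos y z := by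
  have h1 := h.pos_lt y
  have h2 := h.pos_lt z
  have h3 := h.pos_injective.ne hyz
  unfold toward
  dsimp only
  split_ifs
  · omega
  · congr 1; omega
  · congr 1; omega
  · omega

lemma adj_pred (h : IsCyclicOrder F N P pos) {i : ℕ} (h0 : 0 < i) (hi : i < N) :
    F.Adj (P i) (P (i - 1)) := by
  have := h.adj_succ (i - 1) (by omega)
  rw [Nat.sub_add_cancel h0] at this
  exact this.symm

lemma adj_toward (h : IsCyclicOrder F N P pos) {y z : V} (hyz : y ≠ z) :
    F.Adj y (toward P pos y z) ∧
      (pos y < pos (toward P pos y z) ↔ pos y < pos z) := by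
  have h1 := h.pos_lt y
  have h2 := h.pos_lt z
  have h3 := h.pos_injective.ne hyz
  unfold toward
  split_ifs with hlt
  · have := h.adj_succ (pos y) (by omega)
    rw [h.apply_pos] at this
    rw [h.pos_apply _ (by omega)]
    exact ⟨this, by omega⟩
  · have := h.adj_pred (i := pos y) (by omega) h1
    rw [h.apply_pos] at this
    rw [h.pos_apply _ (by omega)]
    exact ⟨this, by omega⟩

/-- Inside the Hamiltonian path, one neighbour comes before and one comes after. -/
lemma pos_lt_iff_not (h : IsCyclicOrder (G.rest m) N P pos) (hm : G.IsMatchingMap m)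
    (hG : G.IsCubic) {x y z : V} (h0 : 0 < pos x) (h1 : pos x < N - 1)
    (hy : (G.rest m).Adj x y) (hz : (G.rest m).Adj x z) (hyz : y ≠ z) :
    pos x < pos y ↔ ¬ pos x < pos z := by
  have e1 := h.adj_succ (pos x) (by omega)
  have e2 := h.adj_pred h0 (h.pos_lt x)
  have p1 := h.pos_apply (pos x + 1) (by omega)
  have p2 := h.pos_apply (pos x - 1) (by omega)
  rw [h.apply_pos] at e1 e2
  have hne : P (pos x + 1) ≠ P (pos x - 1) := fun h' => by
    rw [h', p2] at p1
    omega
  rcases hm.eq_or_eq_of_rest_adj hG hne e1 e2 hy with rfl | rfl <;>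
    rcases hm.eq_or_eq_of_rest_adj hG hne e1 e2 hz with rfl | rfl
  · exact absurd rfl hyz
  · omega
  · omega
  · exact absurd rfl hyz

/-- Switching a Hamiltonian cycle of a bipartite Pfaffian graph so that every vertex of one colour
class, except for the first one, stays between an earlier and a later neighbour. -/
lemma switch_mem_hamMatchings [Fintype V] (h : IsCyclicOrder (G.rest m) N P pos)
    (hm : m ∈ G.hamMatchings) (hG : G.IsCubic) (C : G.Coloring Bool) (hpf : G.IsPfaffian)
    {m' : V → V} (hm' : G.IsMatchingMap m')
    (hmove : ∀ x, C x = C (P 0) → x ≠ P 0 → m' x ≠ m x →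
      (G.rest m).Adj x (m' x) ∧ (pos x < pos (m' x) ↔ pos x < pos (m x))) :
    m' ∈ G.hamMatchings := by
  have hD := h.isPfaffianOrientation (G.rest_le m) C hpf
  have hC := h.color_eq_iff (C.comp (Hom.ofLE (G.rest_le m)))
  have hN := h.even_card (C.comp (Hom.ofLE (G.rest_le m)))
  have hp0 := h.pos_pos
  refine ⟨hm', hm'.connected_rest hG C hD (P 0) fun x y z hx hxu hy hz hyz => ?_⟩
  have hpx : Even (pos x) := by
    have := (hC x (P 0)).1 hx
    rw [this, h.pos_apply 0 hp0]
    exact ⟨0, rfl⟩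
  have h0 : 0 < pos x := by
    rcases Nat.eq_zero_or_pos (pos x) with h0 | h0
    · exact absurd (by rw [← h0, h.apply_pos]) hxu
    · exact h0
  -- `N - 1` is odd and `pos x` is even, so `x` is an inner vertex of the path and has a path
  -- neighbour on either side.
  have h1 : pos x < N - 1 := by
    have := h.pos_lt x
    rw [Nat.even_iff] at hpx
    omega
  have hyG := hy.1
  have hzG := hz.1
  suffices pos x < pos y ↔ ¬ pos x < pos z by
    simpa [posOrientation, hyG, hzG] using this
  rw [hm'.rest_adj] at hy hz
  by_cases hmx : m' x = m x
  · rw [hmx] at hy hz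
    exact h.pos_lt_iff_not hm.1 hG h0 h1 (hm.1.rest_adj.2 hy) (hm.1.rest_adj.2 hz) hyz
  · obtain ⟨e1, e2⟩ := hmove x hx hxu hmx
    -- At a switched vertex the complement gains `m x` and loses `m' x`, which lies on the same
    -- side; the remaining path neighbour `y` lies on the other side.
    have key : ∀ y z, G.Adj x y → m' x ≠ y → z = m x → y ≠ z →
        (pos x < pos y ↔ ¬ pos x < pos z) := by
      rintro y z hy hy' rfl hyz
      rw [← e2]
      exact h.pos_lt_iff_not hm.1 hG h0 h1 (hm.1.rest_adj.2 ⟨hy, hyz.symm⟩) e1 hy'.symm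
    by_cases hzm : z = m x
    · exact key y z hy.1 hy.2 hzm hyz
    · by_cases hym : y = m x
      · have := key z y hz.1 hz.2 hym hyz.symm
        tauto
      · have hy2 := hm.1.rest_adj.2 ⟨hy.1, Ne.symm hym⟩
        have hz2 := hm.1.rest_adj.2 ⟨hz.1, Ne.symm hzm⟩
        rcases hm.1.eq_or_eq_of_rest_adj hG hyz hy2 hz2 e1 with h' | h'
        · exact absurd h' hy.2
        · exact absurd h' hz.2

/-- Given a Hamiltonian cycle through the edge from `P 0` to `e`, either there is a Hamiltonian cycle
that avoids this edge, or there is another one that uses the same edges at `P 0`, and at every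
vertex of its colour class replaces, if anything, the edge leading towards its third neighbour. -/
lemma exists_hamMatchings [Fintype V] (h : IsCyclicOrder (G.rest m) N P pos)
    (hm : m ∈ G.hamMatchings) (hG : G.IsCubic) (C : G.Coloring Bool) (hpf : G.IsPfaffian)
    {e : V} (he : (G.rest m).Adj (P 0) e) :
    (∃ m' ∈ G.hamMatchings, m' (P 0) = e) ∨
      ∃ m' ∈ G.hamMatchings, m' ≠ m ∧ m' (P 0) = m (P 0) ∧
        ∀ x, C x = C (P 0) → m' x ≠ m x → m' x = toward P pos x (m x) := by
  classical
  have hmm := hm.1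
  set u := P 0 with hu
  -- One alternating step: from `z` along the matching edge to `m z`, then along the path edge that
  -- is to replace it. At `u` the replacement is prescribed to be `e`.
  set ψ : V → V := fun z => if z = m u then e else toward P pos (m z) z with hψ
  have hψ1 : ψ (m u) = e := if_pos rfl
  have hψ2 : ∀ z, z ≠ m u → ψ z = toward P pos (m z) z := fun z hz => if_neg hz
  have hadj : ∀ z, (G.rest m).Adj (m z) (ψ z) := by
    intro z
    by_cases hz : z = m u
    · rw [hz, hψ1, hmm.invol]
      exact he
    · rw [hψ2 z hz]
      exact (h.adj_toward (hmm.adj z).ne').1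
  have hcol : ∀ z, C (ψ z) = C z := fun z =>
    Bool.eq_of_ne_of_ne (C.valid (hadj z).1).symm (C.valid (hmm.adj z))
  -- By finiteness, iterating `ψ` from `m u` ends in a periodic orbit. If `m u` itself is not
  -- periodic, that orbit avoids it.
  obtain ⟨w, hw, hwc, hwu⟩ : ∃ w ∈ Function.periodicPts ψ, C w ≠ C u ∧
      (w = m u ∨ ∀ k, ψ^[k] w ≠ m u) := by
    by_cases hc : m u ∈ Function.periodicPts ψ
    · exact ⟨m u, hc, (C.valid (hmm.adj u)).symm, Or.inl rfl⟩
    · obtain ⟨i, hi⟩ := Function.exists_iterate_mem_periodicPts ψ (m u)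
      have hci : ∀ i, C (ψ^[i] (m u)) = C (m u) := by
        intro i
        induction i with
        | zero => rfl
        | succ i ih => rw [Function.iterate_succ_apply', hcol, ih]
      refine ⟨_, hi, ?_, Or.inr fun k hk => hc ?_⟩
      · rw [hci]
        exact (C.valid (hmm.adj u)).symm
      · obtain ⟨n, hn, hp⟩ := hi
        have := hp.apply_iterate k
        rw [hk] at this
        exact ⟨n, hn, this⟩
  set Z : Set V := {x | ∃ k, ψ^[k] w = x} with hZ
  have hZc : ∀ z ∈ Z, C z = C w := by
    rintro _ ⟨k, rfl⟩
    induction k with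
    | zero => rfl
    | succ i ih => rw [Function.iterate_succ_apply', hcol, ih]
  have hwZ : w ∈ Z := ⟨0, rfl⟩
  obtain ⟨m', hm', h1, h2⟩ := hmm.exists_switch ψ
    (Function.bijOn_orbit_of_mem_periodicPts hw)
    (fun z hz hz' => C.valid (hmm.adj z) ((hZc _ hz).trans (hZc _ hz').symm))
    (fun z _ => (hadj z).1)
  have hnZ : ∀ x, C x = C u → x ∉ Z := fun x hx hxZ => hwc ((hZc x hxZ).symm.trans hx)
  have hmv : ∀ x, C x = C u → m' x ≠ m x → m x ∈ Z := fun x hx hne => by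
    by_contra hxZ
    exact hne (h2 x (hnZ x hx) hxZ)
  have htow : ∀ x, C x = C u → x ≠ u → m' x ≠ m x → m' x = toward P pos x (m x) := by
    intro x hx hxu hne
    have := h1 _ (hmv x hx hne)
    rw [hmm.invol, hψ2 _ (hmm.injective.ne hxu), hmm.invol] at this
    exact this
  have hham : m' ∈ G.hamMatchings := by
    refine h.switch_mem_hamMatchings hm hG C hpf hm' fun x hx hxu hne => ?_
    rw [htow x hx hxu hne]
    exact h.adj_toward (hmm.adj x).ne
  -- An orbit through `m u` rematches `u` with `e`; any other orbit leaves `u` alone but changes the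
  -- matching at `w`.
  by_cases hcZ : m u ∈ Z
  · left
    refine ⟨m', hham, ?_⟩
    have := h1 _ hcZ
    rwa [hmm.invol, hψ1] at this
  · right
    have hmu := h2 u (hnZ u rfl) hcZ
    refine ⟨m', hham, fun heq => ?_, hmu, fun x hx hne => htow x hx ?_ hne⟩
    · have h3 := h1 w hwZ
      rw [heq, hmm.invol] at h3
      have := (hmm.rest_adj.1 (hadj w)).2
      rw [hmm.invol] at this
      exact this h3
    · rintro rfl
      exact hne hmu

end IsCyclicOrder

/-! ### Every edge avoids an even number of Hamiltonian cycles -/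

section Parity

open Classical in
/-- Extension by zero of a function on a subtype. -/
noncomputable def extendZero {V : Type*} {p : V → Prop} (β : {w // p w} → ZMod 2) (w : V) :
    ZMod 2 :=
  if h : p w then β ⟨w, h⟩ else 0

open Classical in
/-- The product over the vertices `x` with `q x` of the sum of `β` over the two neighbours of
`x` other than `m x`. -/
noncomputable def restWeight {V : Type*} [Fintype V] (G : SimpleGraph V) (q : V → Prop) (m : V → V)
    (β : V → ZMod 2) : ZMod 2 :=
  ∏ x : {x // q x}, ((∑ w with G.Adj x w, β w) + β (m x))

variable {V : Type*} {G : SimpleGraph V} {m : V → V}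

lemma extendZero_of_not {p : V → Prop} (β : {w // p w} → ZMod 2) {w : V} (h : ¬ p w) :
    extendZero β w = 0 := dif_neg h

lemma extendZero_coe {p : V → Prop} (β : {w // p w} → ZMod 2) (w : {w // p w}) :
    extendZero β w = β w := dif_pos w.2

lemma zmod_two_eq_zero_or_one : ∀ a : ZMod 2, a = 0 ∨ a = 1 := by decide

-- In characteristic two, adding `β (m x)` cancels it from the neighbour sum. In this form each
-- factor depends on `m` only through `m x`, as a matrix entry must.
open Classical in
lemma IsMatchingMap.sum_add [Fintype V] (hm : G.IsMatchingMap m) (hG : G.IsCubic) (β : V → ZMod 2)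
    {x a b : V} (hab : a ≠ b) (ha : (G.rest m).Adj x a) (hb : (G.rest m).Adj x b) :
    (∑ w with G.Adj x w, β w) + β (m x) = β a + β b := by
  have h1 : (Finset.univ.filter fun w => G.Adj x w) = {m x, a, b} := by
    ext w
    simp only [Finset.mem_filter, Finset.mem_univ, true_and, Finset.mem_insert,
      Finset.mem_singleton]
    constructor
    · intro hw
      by_cases hmw : m x = w
      · exact Or.inl hmw.symm
      · exact Or.inr (hm.eq_or_eq_of_rest_adj hG hab ha hb (hm.rest_adj.2 ⟨hw, hmw⟩))
    · rintro (rfl | rfl | rfl)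
      · exact hm.adj x
      · exact ha.1
      · exact hb.1
  rw [h1, Finset.sum_insert, Finset.sum_pair hab]
  · linear_combination CharTwo.add_self_eq_zero (β (m x))
  · simp only [Finset.mem_insert, Finset.mem_singleton, not_or]
    exact ⟨ha.2.1, hb.2.1⟩

variable [Fintype V]

lemma restWeight_eq_one_iff {q : V → Prop} {β : V → ZMod 2} (hm : G.IsMatchingMap m)
    (hG : G.IsCubic) : G.restWeight q m β = 1 ↔
      ∀ x a b, q x → a ≠ b → (G.rest m).Adj x a → (G.rest m).Adj x b → β a + β b = 1 := by
  classical
  constructor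
  · intro h x a b hx hab ha hb
    rw [← hm.sum_add hG β hab ha hb]
    by_contra hne
    have h0 := (zmod_two_eq_zero_or_one _).resolve_right hne
    have : G.restWeight q m β = 0 :=
      Finset.prod_eq_zero (Finset.mem_univ (⟨x, hx⟩ : {x // q x})) h0
    rw [this] at h
    exact zero_ne_one h
  · intro h
    refine Finset.prod_eq_one fun x _ => ?_
    obtain ⟨a, b, hab, hnb⟩ := hm.exists_rest_neighbors hG x.1
    rw [hm.sum_add hG β hab ((hnb a).2 (Or.inl rfl)) ((hnb b).2 (Or.inr rfl))]
    exact h _ a b x.2 hab ((hnb a).2 (Or.inl rfl)) ((hnb b).2 (Or.inr rfl))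

variable {u c : V}

open Classical in
/-- If the complement of `m` is a Hamiltonian cycle, there is exactly one function of weight one. -/
lemma sum_restWeight_of_connected (hm : m ∈ G.hamMatchings) (hG : G.IsCubic) (C : G.Coloring Bool)
    (huc : m u = c) :
    ∑ β : {w // C w ≠ C u ∧ w ≠ c} → ZMod 2,
      G.restWeight (fun x => C x = C u ∧ x ≠ u) m (extendZero β) = 1 := by
  have hmm := hm.1
  obtain ⟨b, b', -, hb⟩ := hmm.exists_rest_neighbors hG u
  obtain ⟨N, P, pos, h, hP0, -⟩ := exists_isCyclicOrder hG hm ((hb b).2 (Or.inl rfl))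
  have hN := h.even_card (C.comp (Hom.ofLE (G.rest_le m)))
  have h0 := h.pos_pos
  have hCe : ∀ x, C x = C u ↔ Even (pos x) := by
    intro x
    have := h.color_apply (C.comp (Hom.ofLE (G.rest_le m))) (pos x) (h.pos_lt x)
    rw [h.apply_pos, hP0] at this
    exact this
  have hcu : C c ≠ C u := by
    rw [← huc]
    exact (C.valid (hmm.adj u)).symm
  have key : ∀ β : V → ZMod 2, G.restWeight (fun x => C x = C u ∧ x ≠ u) m β = 1 ↔
      ∀ t, 0 < t → 2 * t + 1 < N → β (P (2 * t - 1)) + β (P (2 * t + 1)) = 1 := by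
    intro β
    rw [restWeight_eq_one_iff hmm hG]
    have e1 : ∀ t, 0 < t → 2 * t + 1 < N → (G.rest m).Adj (P (2 * t)) (P (2 * t - 1)) ∧
        (G.rest m).Adj (P (2 * t)) (P (2 * t + 1)) ∧ P (2 * t - 1) ≠ P (2 * t + 1) := by
      intro t ht htN
      refine ⟨h.adj_pred (by omega) (by omega), h.adj_succ _ htN, fun h' => ?_⟩
      have := congrArg pos h'
      rw [h.pos_apply _ (by omega), h.pos_apply _ (by omega)] at this
      omega
    constructor
    · intro hβ t ht htN
      obtain ⟨h1, h2, h3⟩ := e1 t ht htN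
      refine hβ (P (2 * t)) _ _ ⟨?_, ?_⟩ h3 h1 h2
      · rw [hCe, h.pos_apply _ (by omega)]
        exact even_two_mul t
      · rintro h'
        have := congrArg pos (h'.trans hP0.symm)
        rw [h.pos_apply _ (by omega), h.pos_apply _ h0] at this
        omega
    · rintro hβ x a b ⟨hx, hxu⟩ hab ha hb
      obtain ⟨t, ht⟩ := (hCe x).1 hx
      have hxN := h.pos_lt x
      have hx0 : pos x ≠ 0 := fun h' => hxu (by rw [← hP0, ← h', h.apply_pos])
      obtain ⟨h1, h2, h3⟩ := e1 t (by omega) (by omega)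
      have hPx : P (2 * t) = x := by rw [two_mul, ← ht, h.apply_pos]
      rw [hPx] at h1 h2
      have := hβ t (by omega) (by omega)
      rcases hmm.eq_or_eq_of_rest_adj hG h3 h1 h2 ha with rfl | rfl <;>
        rcases hmm.eq_or_eq_of_rest_adj hG h3 h1 h2 hb with rfl | rfl
      · exact absurd rfl hab
      · exact this
      · rwa [add_comm]
      · exact absurd rfl hab
  -- The labels must alternate along the odd positions, and the value 0 at `c` fixes the start. No
  -- condition is imposed at `u = P 0`, so nothing has to close up around the cycle.
  set β₀ : {w // C w ≠ C u ∧ w ≠ c} → ZMod 2 :=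
    fun w => ((pos w / 2 + pos c / 2 : ℕ) : ZMod 2) with hβ₀
  have hext : ∀ w, C w ≠ C u → extendZero β₀ w = ((pos w / 2 + pos c / 2 : ℕ) : ZMod 2) := by
    intro w hw
    by_cases hwc : w = c
    · subst hwc
      rw [extendZero_of_not _ (by simp), Nat.cast_add, CharTwo.add_self_eq_zero]
    · exact extendZero_coe β₀ ⟨w, hw, hwc⟩
  have hodd : ∀ t, 2 * t + 1 < N → C (P (2 * t + 1)) ≠ C u := by
    intro t ht
    rw [Ne, hCe, h.pos_apply _ ht]
    simp
  have huniq : ∀ β : {w // C w ≠ C u ∧ w ≠ c} → ZMod 2,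
      G.restWeight (fun x => C x = C u ∧ x ≠ u) m (extendZero β) = 1 ↔ β = β₀ := by
    intro β
    rw [key]
    constructor
    · intro hβ
      have hind : ∀ t, 2 * t + 1 < N →
          extendZero β (P (2 * t + 1)) = extendZero β (P 1) + (t : ZMod 2) := by
        intro t
        induction t with
        | zero => intro _; simp
        | succ t ih =>
          intro ht
          have h1 := hβ (t + 1) (by omega) ht
          rw [show 2 * (t + 1) - 1 = 2 * t + 1 by omega, ih (by omega)] at h1
          push_cast
          linear_combination h1 - CharTwo.add_self_eq_zero (t : ZMod 2) -
            CharTwo.add_self_eq_zero (extendZero β (P 1))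
      have hind' : ∀ w, C w ≠ C u →
          extendZero β w = extendZero β (P 1) + ((pos w / 2 : ℕ) : ZMod 2) := by
        intro w hw
        rw [Ne, hCe, Nat.even_iff] at hw
        have hw' : 2 * (pos w / 2) + 1 = pos w := by omega
        have := hind (pos w / 2) (by rw [hw']; exact h.pos_lt w)
        rwa [hw', h.apply_pos] at this
      have hc := hind' c hcu
      rw [extendZero_of_not _ (by simp)] at hc
      funext w
      rw [← extendZero_coe β, ← extendZero_coe β₀, hext _ w.2.1, hind' _ w.2.1, Nat.cast_add]
      linear_combination -hc - CharTwo.add_self_eq_zero ((pos c / 2 : ℕ) : ZMod 2)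
    · rintro rfl t ht htN
      have e1 := hodd (t - 1) (by omega)
      rw [show 2 * (t - 1) + 1 = 2 * t - 1 by omega] at e1
      rw [hext _ e1, hext _ (hodd t htN), h.pos_apply _ (by omega), h.pos_apply _ htN,
        show (2 * t - 1) / 2 = t - 1 by omega, show (2 * t + 1) / 2 = (t - 1) + 1 by omega]
      push_cast
      linear_combination CharTwo.add_self_eq_zero ((t - 1 : ℕ) : ZMod 2) +
        CharTwo.add_self_eq_zero ((pos c / 2 : ℕ) : ZMod 2)
  rw [Finset.sum_eq_single β₀]
  · exact (huniq β₀).2 rfl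
  · intro β _ hβ
    exact (zmod_two_eq_zero_or_one _).resolve_right fun h' => hβ ((huniq β).1 h')
  · intro h'
    exact absurd (Finset.mem_univ _) h'

open Classical in
/-- If the complement of `m` is disconnected, the functions of weight one come in pairs. -/
lemma sum_restWeight_of_not_connected (hm : G.IsMatchingMap m) (hG : G.IsCubic)
    (C : G.Coloring Bool) (hc : ¬ (G.rest m).Connected) :
    ∑ β : {w // C w ≠ C u ∧ w ≠ c} → ZMod 2,
      G.restWeight (fun x => C x = C u ∧ x ≠ u) m (extendZero β) = 0 := by
  obtain ⟨w₀, hw₀, hw₀c⟩ : ∃ w, C w ≠ C u ∧ ¬ (G.rest m).Reachable w c := by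
    by_contra! hr
    refine hc ((connected_iff _).2 ⟨fun x y => ?_, ⟨u⟩⟩)
    have hr' : ∀ w, (G.rest m).Reachable w c := by
      intro w
      by_cases hw : C w = C u
      · obtain ⟨a, b, -, hab⟩ := hm.exists_rest_neighbors hG w
        have hwa := (hab a).2 (Or.inl rfl)
        exact hwa.reachable.trans (hr a fun h' => C.valid hwa.1 (hw.trans h'.symm))
      · exact hr w hw
    exact (hr' x).trans (hr' y).symm
  -- The indicator of the components other than that of `c`. The two neighbours of `x` in the
  -- complement lie in one component, so adding `κ` preserves every factor; `w₀` shows that `κ ≠ 0`.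
  set κ : {w // C w ≠ C u ∧ w ≠ c} → ZMod 2 :=
    fun w => if (G.rest m).Reachable w c then 0 else 1 with hκ
  have hext : ∀ w, C w ≠ C u →
      extendZero κ w = if (G.rest m).Reachable w c then 0 else 1 := by
    intro w hw
    by_cases hwc : w = c
    · subst hwc
      rw [extendZero_of_not _ (by simp), if_pos (Reachable.refl _)]
    · exact extendZero_coe κ ⟨w, hw, hwc⟩
  have hadd : ∀ (β : {w // C w ≠ C u ∧ w ≠ c} → ZMod 2) w,
      extendZero (β + κ) w = extendZero β w + extendZero κ w := by
    intro β w
    unfold extendZero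
    split_ifs
    · rfl
    · simp
  have hweight : ∀ β : {w // C w ≠ C u ∧ w ≠ c} → ZMod 2,
      G.restWeight (fun x => C x = C u ∧ x ≠ u) m (extendZero (β + κ)) =
        G.restWeight (fun x => C x = C u ∧ x ≠ u) m (extendZero β) := by
    intro β
    refine Finset.prod_congr rfl fun x _ => ?_
    obtain ⟨a, b, hab, hnb⟩ := hm.exists_rest_neighbors hG x.1
    have ha := (hnb a).2 (Or.inl rfl)
    have hb := (hnb b).2 (Or.inr rfl)
    have hCa : C a ≠ C u := fun h' => C.valid ha.1 (x.2.1.trans h'.symm)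
    have hCb : C b ≠ C u := fun h' => C.valid hb.1 (x.2.1.trans h'.symm)
    have hr : (G.rest m).Reachable a c ↔ (G.rest m).Reachable b c := by
      have : (G.rest m).Reachable a b := ha.symm.reachable.trans hb.reachable
      exact ⟨fun h' => this.symm.trans h', fun h' => this.trans h'⟩
    rw [hm.sum_add hG _ hab ha hb, hm.sum_add hG _ hab ha hb, hadd, hadd, hext a hCa, hext b hCb,
      if_congr hr rfl rfl]
    linear_combination CharTwo.add_self_eq_zero
      (if (G.rest m).Reachable b c then (0 : ZMod 2) else 1)
  have hκκ : κ + κ = 0 := by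
    funext w
    exact CharTwo.add_self_eq_zero _
  refine Finset.sum_involution (fun β _ => β + κ) (fun β _ => ?_) (fun β _ _ h' => ?_)
    (fun β _ => Finset.mem_univ _) (fun β _ => ?_)
  · rw [hweight, CharTwo.add_self_eq_zero]
  · have h1 : κ = 0 := by simpa using h'
    have hwc : w₀ ≠ c := by
      rintro rfl
      exact hw₀c (Reachable.refl _)
    have := congrFun h1 ⟨w₀, hw₀, hwc⟩
    simp [hκ, hw₀c] at this
  · rw [add_assoc, hκκ, add_zero]

end Parity

section Parity

variable {V : Type*} {G : SimpleGraph V} {m : V → V} [Fintype V] {u c : V}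

open Classical in
/-- For a fixed function, the total weight of the perfect matchings through an edge vanishes: it is
the determinant of a singular matrix over `ZMod 2`. -/
lemma sum_restWeight_matchings (hG : G.IsCubic) (C : G.Coloring Bool)
    (β : {w // C w ≠ C u ∧ w ≠ c} → ZMod 2) :
    ∑ m : V → V with G.IsMatchingMap m ∧ m u = c,
      G.restWeight (fun x => C x = C u ∧ x ≠ u) m (extendZero β) = 0 := by
  rcases Finset.eq_empty_or_nonempty
    (Finset.univ.filter fun m : V → V => G.IsMatchingMap m ∧ m u = c) with hemp | ⟨m₀, hm₀⟩
  · rw [hemp, Finset.sum_empty]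
  obtain ⟨hm₀, hm₀u⟩ := (Finset.mem_filter.1 hm₀).2
  have hm₀c : m₀ c = u := hm₀.eq_iff.1 hm₀u
  set q : V → Prop := fun x => C x = C u ∧ x ≠ u with hq
  set f : V → ZMod 2 := extendZero β with hf
  set s : V → ZMod 2 := fun x => ∑ w with G.Adj x w, f w with hs
  have hfz : ∀ w, ¬ (C w ≠ C u ∧ w ≠ c) → f w = 0 := fun w hw => extendZero_of_not β hw
  have hcolor : ∀ {m : V → V}, G.IsMatchingMap m → ∀ x y, C (m x) = C (m y) ↔ C x = C y := by
    intro m hm x y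
    have h1 := C.valid (hm.adj x)
    have h2 := C.valid (hm.adj y)
    revert h1 h2
    generalize C x = a
    generalize C y = b
    generalize C (m x) = a'
    generalize C (m y) = b'
    revert a b a' b'; decide
  have hqm : ∀ {m m' : V → V}, G.IsMatchingMap m → G.IsMatchingMap m' → m u = c → m' u = c →
      ∀ x, q x → q (m' (m x)) := by
    intro m m' hm hm' hmu hm'u x hx
    have h1 : m' (m u) = u := by rw [hmu]; exact hm'.eq_iff.1 hm'u
    refine ⟨?_, fun h => hx.2 (hm.injective (hm'.injective (h.trans h1.symm)))⟩
    calc C (m' (m x)) = C (m' (m u)) := (hcolor hm' _ _).2 ((hcolor hm _ _).2 hx.1)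
      _ = C u := by rw [h1]
  -- Columns belong to the other colour class without `c`; the reference matching `m₀` identifies
  -- them with the rows, which makes the matrix square.
  set R : Matrix {x // q x} {x // q x} (ZMod 2) :=
    fun x y => if G.Adj x (m₀ y) then s x + f (m₀ y) else 0 with hR
  have hdet : R.det = 0 := by
    by_cases hβ : β = 0
    · obtain ⟨x, hx⟩ : ∃ x, q x := by
        obtain ⟨b, b', -, hb⟩ := hm₀.exists_rest_neighbors hG u
        have hub := (hb b).2 (Or.inl rfl)
        obtain ⟨x, hxu, hbx, -⟩ := hm₀.exists_other hG hub.symm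
        exact ⟨x, Bool.eq_of_ne_of_ne (C.valid hbx.1).symm (C.valid hub.1), hxu⟩
      have hf0 : f = 0 := by
        funext w
        by_cases hw : C w ≠ C u ∧ w ≠ c
        · rw [hf, hβ]
          exact extendZero_coe 0 ⟨w, hw⟩
        · exact hfz w hw
      refine Matrix.det_eq_zero_of_row_eq_zero (⟨x, hx⟩ : {x // q x}) fun y => ?_
      simp [hR, hs, hf0]
    -- The labelling itself lies in the kernel: since `f w * f w = f w`, row `x` yields `s x * s x +
    -- s x = 0`.
    · refine Matrix.exists_mulVec_eq_zero_iff.1 ⟨fun y => f (m₀ y), fun h0 => hβ ?_, ?_⟩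
      · funext w
        have hqw : q (m₀ w) := by
          refine ⟨?_, fun h => w.2.2 (hm₀.injective (h.trans hm₀c.symm))⟩
          exact Bool.eq_of_ne_of_ne (C.valid (hm₀.adj w)).symm w.2.1.symm
        have := congrFun h0 ⟨m₀ w, hqw⟩
        simp only [hm₀.invol, Pi.zero_apply] at this
        rwa [hf, extendZero_coe] at this
      · funext x
        have h1 : ∑ y : {x // q x}, R x y * f (m₀ y) =
            ∑ w, if G.Adj x w then (s x + f w) * f w else 0 := by
          refine Fintype.sum_of_injective (fun y : {x // q x} => m₀ y)
            (fun y y' h => Subtype.ext (hm₀.injective h)) _ _ (fun w hw => ?_) (fun y => ?_)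
          · have : f w = 0 := by
              refine hfz w fun hw' => hw ⟨⟨m₀ w, ?_, fun h => ?_⟩, hm₀.invol w⟩
              · exact Bool.eq_of_ne_of_ne (C.valid (hm₀.adj w)).symm hw'.1.symm
              · exact hw'.2 (hm₀.injective (h.trans hm₀c.symm))
            simp [this]
          · simp only [hR]
            split_ifs <;> simp
        have h2 : ∀ a : ZMod 2, a * a = a := by decide
        rw [Matrix.mulVec, dotProduct, h1, ← Finset.sum_filter]
        simp only [add_mul, h2, Finset.sum_add_distrib, ← Finset.mul_sum]
        change s x * s x + s x = 0
        rw [h2, CharTwo.add_self_eq_zero]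
  rw [← hdet, ← Matrix.det_transpose, Matrix.det_apply]
  -- Signs are invisible mod 2, so the determinant is a permanent, whose nonvanishing terms come
  -- from perfect matchings through `uc`.
  have hsign : ∀ (σ : Equiv.Perm {x // q x}) (a : ZMod 2), Equiv.Perm.sign σ • a = a := by
    intro σ a
    rcases Int.units_eq_one_or (Equiv.Perm.sign σ) with h | h
    · rw [h, one_smul]
    · rw [h, Units.smul_def]
      simp [ZMod.neg_eq_self_mod_two]
  simp only [hsign, Matrix.transpose_apply]
  have hterm : ∀ σ : Equiv.Perm {x // q x}, ∏ x, R x (σ x) =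
      if ∀ x : {x // q x}, G.Adj x (m₀ (σ x)) then ∏ x : {x // q x}, (s x + f (m₀ (σ x)))
        else 0 := by
    intro σ
    split_ifs with h
    · exact Finset.prod_congr rfl fun x _ => if_pos (h x)
    · push Not at h
      obtain ⟨x, hx⟩ := h
      exact Finset.prod_eq_zero (Finset.mem_univ x) (if_neg hx)
  rw [Finset.sum_congr rfl fun σ _ => hterm σ, ← Finset.sum_filter]
  refine Finset.sum_bij (fun m hm =>
    { toFun := fun x => ⟨m₀ (m x), hqm (Finset.mem_filter.1 hm).2.1 hm₀
        (Finset.mem_filter.1 hm).2.2 hm₀u x x.2⟩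
      invFun := fun x => ⟨m (m₀ x), hqm hm₀ (Finset.mem_filter.1 hm).2.1 hm₀u
        (Finset.mem_filter.1 hm).2.2 x x.2⟩
      left_inv := fun x => Subtype.ext (by simp [hm₀.invol, (Finset.mem_filter.1 hm).2.1.invol])
      right_inv := fun x => Subtype.ext
        (by simp [hm₀.invol, (Finset.mem_filter.1 hm).2.1.invol]) }) ?_ ?_ ?_ ?_
  · intro m hm
    simp only [Finset.mem_filter, Finset.mem_univ, true_and, Equiv.coe_fn_mk, hm₀.invol]
    exact fun x => (Finset.mem_filter.1 hm).2.1.adj x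
  · intro m hm m' hm' heq
    obtain ⟨hm, hmu⟩ := (Finset.mem_filter.1 hm).2
    obtain ⟨hm', hm'u⟩ := (Finset.mem_filter.1 hm').2
    have h1 : ∀ x, C x = C u → m x = m' x := by
      intro x hx
      by_cases hxu : x = u
      · rw [hxu, hmu, hm'u]
      · have := congrArg Subtype.val (Equiv.congr_fun heq ⟨x, hx, hxu⟩)
        exact hm₀.injective this
    funext w
    by_cases hw : C w = C u
    · exact h1 w hw
    · have h2 := h1 (m w) (Bool.eq_of_ne_of_ne (C.valid (hm.adj w)).symm (Ne.symm hw))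
      rw [hm.invol] at h2
      exact (hm'.eq_iff.1 h2.symm).symm
  · intro σ hσ
    have hσ' : ∀ x : {x // q x}, G.Adj x (m₀ (σ x)) := (Finset.mem_filter.1 hσ).2
    set Z : Set V := {w | q (m₀ w)} with hZ
    set ψ : V → V := fun z => if h : q (m₀ z) then m₀ (σ ⟨m₀ z, h⟩) else z with hψ
    have hψZ : ∀ z (h : q (m₀ z)), ψ z = m₀ (σ ⟨m₀ z, h⟩) := fun z h => dif_pos h
    have hbij : Set.BijOn ψ Z Z := by
      refine ⟨fun z hz => ?_, fun z hz z' hz' h => ?_, fun z hz => ?_⟩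
      · change q (m₀ (ψ z))
        rw [hψZ z hz, hm₀.invol]
        exact (σ _).2
      · rw [hψZ z hz, hψZ z' hz'] at h
        have := σ.injective (Subtype.ext (hm₀.injective h))
        exact hm₀.injective (congrArg Subtype.val this)
      · have h1 : q (m₀ (m₀ (σ.symm ⟨m₀ z, hz⟩))) := by
          rw [hm₀.invol]
          exact (σ.symm _).2
        refine ⟨m₀ (σ.symm ⟨m₀ z, hz⟩), h1, ?_⟩
        rw [hψZ _ h1]
        simp [hm₀.invol]
    have hZc : ∀ z, z ∈ Z → C z ≠ C u := fun z hz h =>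
      C.valid (hm₀.adj z) (h.trans hz.1.symm)
    -- The matching belonging to `σ` arises by switching `m₀` at all vertices except `u` and `c`.
    obtain ⟨m, hm, h1, h2⟩ := hm₀.exists_switch ψ hbij (fun z hz hz' => hZc _ hz' hz.1)
      (fun z hz => by rw [hψZ z hz]; exact hσ' ⟨m₀ z, hz⟩)
    have hmu : m u = c := by
      rw [h2 u (fun h => hZc u h rfl) (fun h => ?_), hm₀u]
      change q (m₀ (m₀ u)) at h
      rw [hm₀.invol] at h
      exact h.2 rfl
    refine ⟨m, Finset.mem_filter.2 ⟨Finset.mem_univ _, hm, hmu⟩, ?_⟩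
    ext x
    have hx : q (m₀ (m₀ x)) := by rw [hm₀.invol]; exact x.2
    have := h1 (m₀ x) hx
    rw [hψZ _ hx] at this
    simp only [hm₀.invol] at this
    simp [this, hm₀.invol]
  · intro m hm
    simp only [restWeight, Equiv.coe_fn_mk, hm₀.invol]
    exact Finset.prod_congr (by ext; simp) fun _ _ => rfl

/-- In a cubic bipartite graph, every edge avoids an even number of Hamiltonian cycles. -/
lemma even_ncard_hamMatchings (hG : G.IsCubic) (C : G.Coloring Bool) :
    Even {m ∈ G.hamMatchings | m u = c}.ncard := by
  classical
  have h1 : {m ∈ G.hamMatchings | m u = c} =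
      ((Finset.univ.filter fun m : V → V => G.IsMatchingMap m ∧ m u = c).filter
        fun m => (G.rest m).Connected : Finset (V → V)) := by
    ext m
    simp [hamMatchings, and_assoc, and_comm]
  -- The vanishing double sum over labellings and matchings is reordered: summed over labellings
  -- first, each matching contributes 1 or 0 according to whether its complement is connected.
  rw [h1, Set.ncard_coe_finset, ← ZMod.natCast_eq_zero_iff_even, Finset.card_filter, Nat.cast_sum,
    ← Finset.sum_eq_zero (s := Finset.univ)
      (f := fun β : {w // C w ≠ C u ∧ w ≠ c} → ZMod 2 =>
        ∑ m : V → V with G.IsMatchingMap m ∧ m u = c,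
          G.restWeight (fun x => C x = C u ∧ x ≠ u) m (extendZero β))
      (fun β _ => sum_restWeight_matchings hG C β), Finset.sum_comm]
  refine Finset.sum_congr rfl fun m hm => ?_
  obtain ⟨hm, hmu⟩ := (Finset.mem_filter.1 hm).2
  split_ifs with hc
  · rw [sum_restWeight_of_connected ⟨hm, hc⟩ hG C hmu, Nat.cast_one]
  · rw [sum_restWeight_of_not_connected hm hG C hc, Nat.cast_zero]

end Parity

end SimpleGraph

/-! ### From parity and switching to six Hamiltonian cycles -/

namespace SimpleGraph

variable {V : Type*} {G F : SimpleGraph V} {N : ℕ} {P : ℕ → V} {pos : V → ℕ} {m : V → V}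

/-- A perfect matching is determined by a Hamiltonian path if it differs from `m`, at every
vertex, at most by the edge that leads towards the partner under `m`. -/
lemma IsCyclicOrder.eq_of_forall_toward (h : IsCyclicOrder F N P pos)
    (hm : G.IsMatchingMap m) {m' : V → V} (hm' : G.IsMatchingMap m')
    (hmove : ∀ x, m' x ≠ m x → m' x = toward P pos x (m x)) : m' = m := by
  by_contra hne
  obtain ⟨y, hy⟩ := Function.ne_iff.1 hne
  -- Take the first moved vertex `x`. Its old partner comes later, so its new partner `w` is the
  -- next vertex. As `w` is sent back to `x`, its old partner precedes `w`; by minimality it is `x`,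
  -- a contradiction.
  obtain ⟨x, hx, hmin⟩ := exists_minimalFor_of_wellFoundedLT (fun x => m' x ≠ m x) pos ⟨y, hy⟩
  have hinj := h.pos_injective
  have moved : ∀ z, m' z ≠ m z → m' (m' z) ≠ m (m' z) := by
    intro z hz h'
    rw [hm'.invol] at h'
    exact hz (hm.eq_iff.2 h'.symm).symm
  have moved' : ∀ z, m' z ≠ m z → m' (m z) ≠ m (m z) := by
    intro z hz h'
    rw [hm.invol] at h'
    exact hz (hm'.eq_iff.2 h')
  have hmin' : ∀ z, m' z ≠ m z → pos x ≤ pos z := fun z hz => by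
    by_contra hlt
    exact hlt (hmin hz (by omega))
  have h1 := hmove x hx
  have hxm := hinj.ne (hm.adj x).ne
  have hlt : pos x < pos (m x) := lt_of_le_of_ne (hmin' _ (moved' x hx)) hxm
  set w := m' x with hw
  have hwx : pos w = pos x + 1 := by
    rw [h1, toward, if_pos hlt, h.pos_apply]
    have := h.pos_lt (m x)
    omega
  have h2 := hmove w (moved x hx)
  rw [hw, hm'.invol, ← hw] at h2
  have h3 := hmin' _ (moved' w (moved x hx))
  have h4 : ¬ pos w < pos (m w) := by
    intro hlt'
    rw [toward, if_pos hlt'] at h2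
    have := congrArg pos h2
    rw [h.pos_apply] at this
    · omega
    · have := h.pos_lt (m w)
      omega
  have h5 := hinj.ne (hm.adj w).ne
  have h6 : m w = x := hinj (by omega)
  exact hx (hm.eq_iff.1 h6).symm

/-- A Hamiltonian cubic bipartite Pfaffian graph in which every edge avoids an even number of
Hamiltonian cycles has at least six of them. -/
lemma six_le_ncard_hamMatchings [Fintype V] (hG : G.IsCubic) (C : G.Coloring Bool)
    (hpf : G.IsPfaffian)
    (heven : ∀ u c, G.Adj u c → Even {m ∈ G.hamMatchings | m u = c}.ncard)
    (hne : G.hamMatchings.Nonempty) : 6 ≤ G.hamMatchings.ncard := by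
  classical
  by_contra! hlt
  have hfin : G.hamMatchings.Finite := Set.toFinite _
  -- The matchings through a given edge.
  set S : V → V → Set (V → V) := fun u c => {m ∈ G.hamMatchings | m u = c} with hS
  have hSfin : ∀ u c, (S u c).Finite := fun u c => hfin.subset fun _ h => h.1
  have two_le : ∀ u m, m ∈ G.hamMatchings → 2 ≤ (S u (m u)).ncard := by
    intro u m hm
    have h1 : 0 < (S u (m u)).ncard := (Set.ncard_pos (hSfin _ _)).2 ⟨m, hm, rfl⟩
    obtain ⟨k, hk⟩ := heven u (m u) (hm.1.adj u)
    change (S u (m u)).ncard = k + k at hk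
    omega
  have hadd : ∀ u c d, c ≠ d → (S u c).ncard + (S u d).ncard =
      (S u c ∪ S u d).ncard := by
    intro u c d hcd
    rw [Set.ncard_union_eq _ (hSfin _ _) (hSfin _ _)]
    rw [Set.disjoint_left]
    rintro m ⟨-, h1⟩ ⟨-, h2⟩
    exact hcd (h1.symm.trans h2)
  have hsub : ∀ u c d, S u c ∪ S u d ⊆ G.hamMatchings := by
    rintro u c d m (hm | hm) <;> exact hm.1
  -- Two nonempty classes of even size among at most five matchings have exactly two members each,
  -- and leave no room for a third class.
  have two : ∀ u m m', m ∈ G.hamMatchings → m' ∈ G.hamMatchings → m u ≠ m' u →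
      (S u (m u)).ncard = 2 ∧ ∀ m'' ∈ G.hamMatchings, m'' u = m u ∨ m'' u = m' u := by
    intro u m m' hm hm' hne
    have h1 := two_le u m hm
    have h2 := two_le u m' hm'
    have h3 := hadd u _ _ hne
    have h4 := Set.ncard_le_ncard (hsub u (m u) (m' u)) hfin
    obtain ⟨k, hk⟩ := heven u (m u) (hm.1.adj u)
    change (S u (m u)).ncard = k + k at hk
    refine ⟨by omega, fun m'' hm'' => ?_⟩
    by_contra! h5
    have h6 := two_le u m'' hm''
    have h7 : (S u (m u) ∪ S u (m' u) ∪ S u (m'' u)).ncard =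
        (S u (m u) ∪ S u (m' u)).ncard + (S u (m'' u)).ncard := by
      refine Set.ncard_union_eq ?_ ((hSfin _ _).union (hSfin _ _)) (hSfin _ _)
      rw [Set.disjoint_left]
      rintro f (⟨-, h1⟩ | ⟨-, h1⟩) ⟨-, h2⟩
      · exact h5.1 (h2.symm.trans h1)
      · exact h5.2 (h2.symm.trans h1)
    have h8 := Set.ncard_le_ncard
      (Set.union_subset (hsub u (m u) (m' u)) (fun f (hf : f ∈ S u (m'' u)) => hf.1)) hfin
    omega
  -- If some edge at `u` is in every Hamiltonian cycle, the cycle can be switched away from `u`.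
  have step : ∀ {N P pos m}, IsCyclicOrder (G.rest m) N P pos → m ∈ G.hamMatchings →
      ∃ m' ∈ G.hamMatchings, m' ≠ m ∧ m' (P 0) = m (P 0) ∧
        ∀ x, C x = C (P 0) → m' x ≠ m x → m' x = IsCyclicOrder.toward P pos x (m x) := by
    intro N P pos m h hm
    obtain ⟨a, b, hab, hnb⟩ := hm.1.exists_rest_neighbors hG (P 0)
    have ha := (hnb a).2 (Or.inl rfl)
    have hb := (hnb b).2 (Or.inr rfl)
    rcases h.exists_hamMatchings hm hG C hpf ha with ⟨m1, hm1, h1⟩ | h1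
    · rcases h.exists_hamMatchings hm hG C hpf hb with ⟨m2, hm2, h2⟩ | h2
      -- Here `m`, `m1` and `m2` would use all three edges at `P 0`.
      · exfalso
        have hma := (hm.1.rest_adj.1 ha).2
        have hmb := (hm.1.rest_adj.1 hb).2
        rcases (two (P 0) m m1 hm hm1 (by rwa [h1])).2 m2 hm2 with h3 | h3
        · exact hmb (h3.symm.trans h2)
        · exact hab (h1.symm.trans (h3.symm.trans h2))
      · exact h2
    · exact h1
  obtain ⟨m, hm⟩ := hne
  obtain ⟨m1, hm1, hm1m⟩ : ∃ m1 ∈ G.hamMatchings, m1 ≠ m := by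
    obtain ⟨u⟩ := hm.2.nonempty
    obtain ⟨a, b, hab, hnb⟩ := hm.1.exists_rest_neighbors hG u
    obtain ⟨N, P, pos, h, -, -⟩ := exists_isCyclicOrder hG hm ((hnb a).2 (Or.inl rfl))
    obtain ⟨m', hm', h1, -⟩ := step h hm
    exact ⟨m', hm', h1⟩
  obtain ⟨u, hu⟩ := Function.ne_iff.1 hm1m
  have huv : (G.rest m).Adj u (m1 u) := hm.1.rest_adj.2 ⟨hm1.1.adj u, hu.symm⟩
  -- The edge from `u` to `m1 u` is made the closing edge of the cycle, so that the path and its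
  -- reverse start at its two ends, which have different colours.
  obtain ⟨N, P, pos, h, rfl, hlast⟩ := exists_isCyclicOrder hG hm huv
  obtain ⟨m2, hm2, hne2, heq2, hmove2⟩ := step h hm
  obtain ⟨m3, hm3, hne3, heq3, hmove3⟩ := step h.reverse hm
  simp only [Nat.sub_zero, hlast] at heq3 hmove3
  have h3 : m3 (P 0) = m (P 0) := by
    rcases (two (P 0) m m1 hm hm1 hu.symm).2 m3 hm3 with h3 | h3
    · exact h3
    · exfalso
      have h4 := hm3.1.eq_iff.1 h3
      rw [heq3] at h4
      exact hu (hm.1.eq_iff.1 h4).symm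
  -- Only two matchings contain the edge from `P 0` to `m (P 0)`, and both `m2` and `m3` are the one
  -- other than `m`.
  have h23 : m2 = m3 := by
    by_contra h23
    have hsub3 : ({m, m2, m3} : Set (V → V)) ⊆ S (P 0) (m (P 0)) := by
      rintro f (rfl | rfl | rfl)
      · exact ⟨hm, rfl⟩
      · exact ⟨hm2, heq2⟩
      · exact ⟨hm3, h3⟩
    have h5 := Set.ncard_le_ncard hsub3 (hSfin _ _)
    rw [(two (P 0) m m1 hm hm1 hu.symm).1] at h5
    have h6 : ({m, m2, m3} : Set (V → V)).ncard = 3 :=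
      Set.ncard_eq_three.2 ⟨m, m2, m3, hne2.symm, hne3.symm, h23, rfl⟩
    omega
  subst h23
  -- The two switchings control one colour class each.
  refine hne2 (h.eq_of_forall_toward hm.1 hm2.1 fun x hx => ?_)
  by_cases hc : C x = C (P 0)
  · exact hmove2 x hc hx
  · have hc' : C x = C (m1 (P 0)) :=
      Bool.eq_of_ne_of_ne hc (C.valid (hm1.1.adj (P 0))).symm
    rw [hmove3 x hc' hx]
    exact h.toward_reverse (hm.1.adj x).ne

end SimpleGraph

namespace SimpleGraph

variable {V : Type*} {G : SimpleGraph V}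

lemma IsRegularOfDegree.isCubic [Fintype V] [DecidableRel G.Adj] (h : G.IsRegularOfDegree 3) :
    G.IsCubic := fun x => by
  rw [← h x, Set.ncard_eq_toFinset_card', ← card_neighborFinset_eq_degree]
  rfl

/-- A cubic bipartite Pfaffian graph with a Hamiltonian cycle has at least six of them. -/
theorem six_le_ncard_hamiltonianCycles [Fintype V] [DecidableEq V] (hG : G.IsCubic)
    (hb : G.IsBipartite) (hpf : G.IsPfaffian) (hne : G.hamiltonianCycles ≠ ∅) :
    6 ≤ G.hamiltonianCycles.ncard := by
  obtain ⟨C₀⟩ := hb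
  let C : G.Coloring Bool := Coloring.mk (fun x => finTwoEquiv (C₀ x))
    fun h h' => C₀.valid h (finTwoEquiv.injective h')
  rw [ncard_hamiltonianCycles hG]
  refine six_le_ncard_hamMatchings hG C hpf (fun u c _ => even_ncard_hamMatchings hG C) ?_
  rw [← image_restSubgraph_hamMatchings hG, ← Set.nonempty_iff_ne_empty] at hne
  exact hne.of_image

end SimpleGraph

/-! ### The cube has exactly six Hamiltonian cycles -/

namespace SimpleGraph

namespace Cube

/-- Change the coordinate `i` of a vertex of the cube. -/
def flip (x : Fin 3 → Bool) (i : Fin 3) : Fin 3 → Bool := fun j => if j = i then !x j else x j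

/-- The arc between `x` and `flip x i` leaves `x`. -/
def isOut (x : Fin 3 → Bool) (i : Fin 3) : Bool :=
  x i == (List.finRange 3).foldr (fun j b => if j < i then xor (x j) b else b) false

lemma adj_iff : ∀ x y, cubeGraph.Adj x y ↔ ∃ i, y = flip x i := by
  decide +kernel

/-- Orientation of the cube in which every face has an odd number of arcs in either direction. -/
def orientation : Digraph (Fin 3 → Bool) where
  Adj x y := ∃ i, y = flip x i ∧ isOut x i = true

instance : DecidableRel orientation.Adj := fun x y =>
  inferInstanceAs (Decidable (∃ i, y = flip x i ∧ isOut x i = true))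

lemma isOrientation : cubeGraph.IsOrientation orientation where
  adj_of_arc := by decide +kernel
  arc_of_adj := by decide +kernel
  not_both := by decide +kernel

lemma flip_flip : ∀ x i, flip (flip x i) i = x := by decide +kernel

lemma flip_injective : ∀ x, Function.Injective (flip x) := by
  unfold Function.Injective
  decide +kernel

/-- The list misses a vertex all of whose neighbours it contains. -/
def isolates (l : List (Fin 3 → Bool)) : Prop := ∃ v, v ∉ l ∧ ∀ i, flip v i ∈ l

instance (l : List (Fin 3 → Bool)) : Decidable (isolates l) :=
  inferInstanceAs (Decidable (∃ v, v ∉ l ∧ ∀ i, flip v i ∈ l))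

/-- Every path from `x` to `a` that avoids `l` closes up to a cycle with an odd number of arcs in
the given direction, unless that cycle isolates a vertex. Here `b` is the parity so far. -/
def check (a : Fin 3 → Bool) : ℕ → (Fin 3 → Bool) → List (Fin 3 → Bool) → Bool → Bool
  | 0, _, _, _ => false
  | n + 1, x, l, b => (List.finRange 3).all fun i =>
      if flip x i = a then decide (l.length = 2) || xor b (isOut x i) || decide (isolates l)
      else decide (flip x i ∈ l) || check a n (flip x i) (flip x i :: l) (xor b (isOut x i))

/-- An exhaustive search. Running out of fuel counts as failure, so success also confirms that 8 is
enough. -/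
lemma check_eq_true : ∀ a i, check a 8 (flip a i) [flip a i, a] (isOut a i) = true := by
  decide +kernel

lemma orientation_adj_flip (x : Fin 3 → Bool) (i : Fin 3) :
    orientation.Adj x (flip x i) ↔ isOut x i = true :=
  ⟨fun ⟨_, hj, h⟩ => flip_injective x hj ▸ h, fun h => ⟨i, rfl, h⟩⟩

-- Induction along `q`, which is one of the paths explored by `check`; `l` collects the vertices
-- already visited. The length condition rules out walking straight back along the first edge, and
-- the last hypothesis rules out the exemption for isolated vertices.
open Classical in
lemma odd_of_check {a : Fin 3 → Bool} : ∀ (n : ℕ) {x : Fin 3 → Bool} (l : List (Fin 3 → Bool))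
    (b : Bool) (q : cubeGraph.Walk x a), check a n x l b = true → q.IsPath → x ≠ a →
    q.length ≤ n → l.length + q.length ≠ 3 → x ∈ l → a ∈ l →
    (∀ z ∈ q.support.tail, z ≠ a → z ∉ l) →
    (¬ ∃ v, v ∉ l ∧ v ∉ q.support ∧ ∀ i, flip v i ∈ l ∨ flip v i ∈ q.support) →
    Odd (b.toNat + q.darts.countP fun d => orientation.Adj d.fst d.snd)
  | 0, x, l, b, q, h, _, _, _, _, _, _, _, _ => by simp [check] at h
  | n + 1, x, l, b, .nil, _, _, hxa, _, _, _, _, _, _ => absurd rfl hxa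
  | n + 1, x, l, b, .cons (v := y) hxy q, h, hq, hxa, hlen, h3, hxl, hal, hdis, hiso => by
    obtain ⟨i, rfl⟩ := (adj_iff x y).1 hxy
    rw [check, List.all_eq_true] at h
    replace h := h i (List.mem_finRange i)
    rw [Walk.cons_isPath_iff] at hq
    have hpar : ∀ k : ℕ, Odd ((xor b (isOut x i)).toNat + k) ↔
        Odd (b.toNat + (k + if isOut x i = true then 1 else 0)) := by
      intro k
      cases b <;> cases isOut x i <;> simp [Nat.odd_add, Nat.even_add_one, add_comm, parity_simps]
    have hc : (Walk.cons hxy q).darts.countP (fun d => orientation.Adj d.fst d.snd) =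
        q.darts.countP (fun d => orientation.Adj d.fst d.snd) +
          if isOut x i = true then 1 else 0 := by
      rw [Walk.darts_cons, List.countP_cons]
      simp [orientation_adj_flip]
    rw [hc, ← hpar]
    by_cases hya : flip x i = a
    · subst hya
      obtain rfl := (Walk.isPath_iff_nil.1 hq.1).eq_nil
      rw [if_pos rfl] at h
      simp only [Walk.length_cons, Walk.length_nil] at h3
      have h2 : ¬ l.length = 2 := by omega
      have h4 : ¬ isolates l := by
        rintro ⟨v, hv, hv'⟩
        refine hiso ⟨v, hv, ?_, fun i => .inl (hv' i)⟩
        simp only [Walk.support_cons, Walk.support_nil, List.mem_cons, List.not_mem_nil, or_false]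
        rintro (rfl | rfl) <;> contradiction
      simp only [h2, h4, decide_false, Bool.false_or, Bool.or_false] at h
      simp [h]
    · rw [if_neg hya] at h
      have hyl : flip x i ∉ l := hdis _ (by simp) hya
      simp only [hyl, decide_false, Bool.false_or] at h
      refine odd_of_check n _ _ q h hq.1 hya (by simpa using hlen)
        (by simp only [Walk.length_cons, List.length_cons] at h3 ⊢; omega) (by simp)
        (by simp [hal]) ?_ ?_
      · intro z hz hza hzl
        rcases List.mem_cons.1 hzl with rfl | hzl
        · have := hq.1.support_nodup
          rw [← Walk.cons_tail_support] at this
          exact (List.nodup_cons.1 this).1 hz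
        · exact hdis z (by simpa using List.mem_of_mem_tail hz) hza hzl
      · rintro ⟨v, hv, hvq, hv'⟩
        refine hiso ⟨v, fun h => hv (by simp [h]), ?_, fun j => ?_⟩
        · rw [Walk.support_cons, List.mem_cons]
          rintro (rfl | h)
          · exact hv (by simp [hxl])
          · exact hvq h
        · rw [Walk.support_cons]
          rcases hv' j with h | h
          · rcases List.mem_cons.1 h with h | h
            · right; rw [h]; simp
            · exact .inl h
          · exact .inr (by simp [h])

lemma isPfaffian : cubeGraph.IsPfaffian := by
  refine ⟨orientation, isOrientation, fun a p hp hpc => ?_⟩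
  obtain ⟨M, hM⟩ := hpc
  cases p with
  | nil => exact absurd rfl hp.ne_nil
  | @cons _ x _ hax q =>
    obtain ⟨i, rfl⟩ := (adj_iff a x).1 hax
    have h3 := hp.three_le_length
    rw [Walk.length_cons] at h3
    have hq := (Walk.cons_isCycle_iff q hax).1 hp
    have hlen : q.length ≤ 8 := by
      have := hq.1.length_lt
      simp at this
      omega
    have key := odd_of_check 8 [flip a i, a] (isOut a i) q (check_eq_true a i) hq.1 hax.ne' hlen
      (by simp; omega) (by simp) (by simp) ?_ ?_
    · unfold Walk.arcsInCommon
      rw [Walk.darts_cons, List.countP_cons]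
      convert key using 1
      rw [add_comm]
      congr 1
      · simp only [decide_eq_true_eq, orientation_adj_flip]
        cases isOut a i <;> rfl
      · exact List.countP_congr (by simp)
    · intro z hz hza hzl
      have := hq.1.support_nodup
      rw [← Walk.cons_tail_support] at this
      simp only [List.mem_cons, List.not_mem_nil, or_false, hza] at hzl
      exact (List.nodup_cons.1 this).1 (hzl ▸ hz)
    · rintro ⟨v, -, hvq, hv'⟩
      have hv : v ∉ (Walk.cons hax q).support := by
        rw [Walk.support_cons, List.mem_cons, not_or]
        exact ⟨fun h => hvq (h ▸ q.end_mem_support), hvq⟩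
      -- Centrality enters only here: the partner of `v` is a neighbour of `v` off the cycle, so `v`
      -- is not isolated.
      obtain ⟨⟨w, hw⟩, hvw, -⟩ := hM.1 (hM.2 ⟨v, hv⟩)
      obtain ⟨j, rfl⟩ := (adj_iff v w).1 (M.adj_sub hvw)
      apply hw
      rw [Walk.support_cons]
      rcases hv' j with h | h
      · simp only [List.mem_cons, List.not_mem_nil, or_false] at h
        rcases h with h | h
        · rw [h]; simp
        · rw [h]; simp
      · simp [h]

lemma isRegularOfDegree : cubeGraph.IsRegularOfDegree 3 := by
  unfold IsRegularOfDegree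
  decide +kernel

lemma isBipartite : cubeGraph.IsBipartite := by
  refine ⟨(recolorOfEquiv cubeGraph finTwoEquiv.symm)
    (Coloring.mk (fun x => xor (x 0) (xor (x 1) (x 2))) ?_)⟩
  intro x y h
  revert x y
  decide +kernel

lemma hamMatchings_nonempty : cubeGraph.hamMatchings.Nonempty := by
  refine ⟨fun x => flip x (if x 0 then 2 else 1), ⟨?_, ?_⟩, ?_⟩
  · decide +kernel
  · decide +kernel
  -- A Gray code: the list for `j` contains the times at which bit `j` is set.
  · let g : ℕ → Fin 3 → Bool := fun n j =>
      (![[1, 2, 5, 6], [2, 3, 4, 5], [4, 5, 6, 7]] j).contains n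
    rw [connected_iff_exists_forall_reachable]
    have h : ∀ n < 8, (cubeGraph.rest fun x => flip x (if x 0 then 2 else 1)).Reachable
        (g 0) (g n) := by
      intro n
      induction n with
      | zero => exact fun _ => .rfl
      | succ n ih =>
        intro hn
        refine (ih (by omega)).trans (Adj.reachable ?_)
        have : ∀ n < 7, cubeGraph.Adj (g n) (g (n + 1)) ∧
          flip (g n) (if g n 0 then 2 else 1) ≠ g (n + 1) ∧
          flip (g (n + 1)) (if g (n + 1) 0 then 2 else 1) ≠ g n := by
          decide +kernel
        exact this n (by omega)
    refine ⟨g 0, fun v => ?_⟩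
    have hs : ∀ v, ∃ n < 8, g n = v := by decide +kernel
    obtain ⟨n, hn, rfl⟩ := hs v
    exact h n hn

/-- The vertices of one colour class. -/
def evenVertex : Fin 4 → Fin 3 → Bool :=
  ![![false, false, false], ![false, true, true], ![true, false, true], ![true, true, false]]

lemma exists_evenVertex : ∀ x, (∃ k, x = evenVertex k) ∨ ∀ i, ∃ k, flip x i = evenVertex k := by
  decide +kernel

/-- A perfect matching is given by the directions of its edges at the four even vertices. Of the
nine perfect matchings, the three with a single direction are excluded, because their complement
consists of two opposite faces. -/
lemma ncard_hamMatchings_le : cubeGraph.hamMatchings.ncard ≤ 6 := by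
  have hd : ∀ m : (Fin 3 → Bool) → Fin 3 → Bool, ∃ d : Fin 4 → Fin 3,
      cubeGraph.IsMatchingMap m → ∀ k, m (evenVertex k) = flip (evenVertex k) (d k) := by
    intro m
    by_cases hm : cubeGraph.IsMatchingMap m
    · choose d hd using fun k => (adj_iff _ _).1 (hm.adj (evenVertex k))
      exact ⟨d, fun _ => hd⟩
    · exact ⟨0, fun h => absurd h hm⟩
  choose d hd using hd
  let S : Finset (Fin 4 → Fin 3) := {e | (∀ k l, flip (evenVertex k) (e k) =
    flip (evenVertex l) (e l) → k = l) ∧ ∃ k, e k ≠ e 0}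
  have hS : S.card = 6 := by decide +kernel
  have hodd : ∀ {m}, cubeGraph.IsMatchingMap m → ∀ {x}, (¬ ∃ k, x = evenVertex k) →
      ∃ k, m x = evenVertex k := by
    intro m hm x hx
    obtain ⟨i, hi⟩ := (adj_iff _ _).1 (hm.adj x)
    rw [hi]
    exact (exists_evenVertex x).resolve_left hx i
  rw [← hS, ← Set.ncard_coe_finset]
  refine Set.ncard_le_ncard_of_injOn d ?_ ?_ (Finset.finite_toSet S)
  · rintro m ⟨hm, hc⟩
    refine Finset.mem_coe.2 (Finset.mem_filter.2 ⟨Finset.mem_univ _, fun k l h => ?_, ?_⟩)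
    · rw [← hd m hm, ← hd m hm] at h
      have hinj : Function.Injective evenVertex := by
        unfold Function.Injective
        decide +kernel
      exact hinj (hm.injective h)
    · by_contra! hcon
      have hflip : ∀ x, m x = flip x (d m 0) := by
        intro x
        by_cases hx : ∃ k, x = evenVertex k
        · obtain ⟨k, rfl⟩ := hx
          rw [hd m hm, hcon]
        · obtain ⟨k, hk⟩ := hodd hm hx
          have h1 := hd m hm k
          rw [hcon, ← hk, hm.invol] at h1
          exact (flip_flip _ _).symm.trans (congrArg (flip · _) h1.symm)
      have hstep : ∀ x y, (cubeGraph.rest m).Adj x y → x (d m 0) = y (d m 0) := by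
        intro x y h
        obtain ⟨j, rfl⟩ := (adj_iff x y).1 h.1
        have hj : d m 0 ≠ j := by
          rintro rfl
          exact h.2.1 (hflip x)
        simp [flip, hj]
      have hreach : ∀ x y, (cubeGraph.rest m).Reachable x y → x (d m 0) = y (d m 0) := by
        rintro x y ⟨p⟩
        induction p with
        | nil => rfl
        | cons h _ ih => exact (hstep _ _ h).trans ih
      exact absurd (hreach _ _ (hc.preconnected (fun _ => true) (fun _ => false))) (by simp)
  · rintro m ⟨hm, -⟩ m' ⟨hm', -⟩ h
    have heven : ∀ k, m (evenVertex k) = m' (evenVertex k) := fun k => by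
      rw [hd m hm, hd m' hm', h]
    funext x
    by_cases hx : ∃ k, x = evenVertex k
    · obtain ⟨k, rfl⟩ := hx
      exact heven k
    · obtain ⟨k, hk⟩ := hodd hm hx
      have h1 := heven k
      rw [← hk, hm.invol] at h1
      exact (hm'.eq_iff.1 h1.symm).symm

lemma ncard_hamiltonianCycles_eq : cubeGraph.hamiltonianCycles.ncard = 6 := by
  refine le_antisymm ?_ ?_
  · rw [ncard_hamiltonianCycles isRegularOfDegree.isCubic]
    exact ncard_hamMatchings_le
  · refine six_le_ncard_hamiltonianCycles isRegularOfDegree.isCubic isBipartite isPfaffian ?_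
    rw [← image_restSubgraph_hamMatchings isRegularOfDegree.isCubic]
    exact (hamMatchings_nonempty.image _).ne_empty

end Cube

end SimpleGraph

theorem corollary5 :
    (∀ (V : Type*) [Fintype V] [DecidableEq V] (G : SimpleGraph V) [DecidableRel G.Adj],
      G.IsRegularOfDegree 3 → G.IsBipartite → G.IsPfaffian →
        G.hamiltonianCycles = ∅ ∨ 6 ≤ G.hamiltonianCycles.ncard) ∧
    (SimpleGraph.cubeGraph.IsRegularOfDegree 3 ∧ SimpleGraph.cubeGraph.IsBipartite ∧
      SimpleGraph.cubeGraph.IsPfaffian ∧ SimpleGraph.cubeGraph.hamiltonianCycles.ncard = 6) := by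
  refine ⟨fun V _ _ G _ hG hb hpf => ?_, SimpleGraph.Cube.isRegularOfDegree,
    SimpleGraph.Cube.isBipartite, SimpleGraph.Cube.isPfaffian,
    SimpleGraph.Cube.ncard_hamiltonianCycles_eq⟩
  by_cases hne : G.hamiltonianCycles = ∅
  · exact .inl hne
  · exact .inr (SimpleGraph.six_le_ncard_hamiltonianCycles hG.isCubic hb hpf hne)
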